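/- Let $(M,g)$ be a smooth $4$-dimensional Riemannian manifold (without boundary) with Levi-Civita connection $\nabla^g$. Let $V$ be a smooth vector field and $T$ a smooth $3$-form on $M$, and let $\nabla$ be the orthogonal connection without Cartan type torsion given by $$\nabla_XY=\nabla^g_XY+\langle X,Y\rangle V-\langle V,Y\rangle X+T(X,Y,\cdot)^\sharp .$$ For a connection $\nabla$ put $\operatorname{riem}(X,Y,Z,W)=\langle\nabla_X\nabla_YZ-\nabla_Y\nabla_XZ-\nabla_{[X,Y]}Z,W\rangle$; write $\operatorname{riem}$ for the curvature of the connection above and $\operatorname{riem}^g$ for that of $\nabla^g$. Let $e_1,\dots,e_4$ be any orthonormal basis of $T_pM$, $p\in M$. For a $(4,0)$-tensor $Q$ let $$c(Q)(X,Y)=\sum_i Q(e_i,X,Y,e_i),\qquad b(Q)(X,Y,Z,W)=\tfrac13\big(Q(X,Y,Z,W)+Q(Y,Z,X,W)+Q(Z,X,Y,W)\big)$$ be the Ricci contraction and the Bianchi map. For $(2,0)$-tensors $h,k$ let $$(h\owedge k)(X,Y,Z,W)=h(X,Z)k(Y,W)+h(Y,W)k(X,Z)-h(X,W)k(Y,Z)-h(Y,Z)k(X,W).$$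 An algebraic curvature tensor is a $(4,0)$-tensor $Q$ that is anti-symmetric in the first and in the last pair of its entries and satisfies $Q(X,Y,Z,W)=Q(Z,W,X,Y)$ and $b(Q)=0$; its algebraic Weyl tensor is, with $n=4$, $$\operatorname{weyl}(Q)=Q+\tfrac1{n-2}\,h(Q)\owedge g+\tfrac1{2n(n-1)}\,s(Q)\,g\owedge g,\qquad s(Q)=\operatorname{tr}_g c(Q),\quad h(Q)=c(Q)-\tfrac1n s(Q)\,g .$$ Let $\operatorname{riem}^S(X,Y,Z,W)=\tfrac12\big(\operatorname{riem}(X,Y,Z,W)+\operatorname{riem}(Z,W,X,Y)\big)$ and $\operatorname{riem}^S_{\ker}=\operatorname{riem}^S-b(\operatorname{riem}^S)$. Let $\operatorname{ric}=c(\operatorname{riem})$, let $\operatorname{ric}^S$ be the symmetric part of $\operatorname{ric}$, and let $R=\operatorname{tr}_g\operatorname{ric}$. Let $C^g=\operatorname{weyl}(\operatorname{riem}^g)$ be the Weyl curvature of $\nabla^g$. Tensor norms are $\|P\|^2=\sum_{i_1,\dots,i_k}P(e_{i_1},\dots,e_{i_k})^2$. Then, at every point $p$ of $M$, $\operatorname{riem}^g$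 and $\operatorname{riem}^S_{\ker}$ are algebraic curvature tensors on $T_pM$, and $$C^g=\operatorname{weyl}(\operatorname{riem}^S_{\ker}),\qquad \|\operatorname{riem}^S_{\ker}\|^2=\|C^g\|^2+2\,\|\operatorname{ric}^S\|^2-\tfrac13R^2 .$$ -/

import Mathlib

open Bundle FiberBundle VectorField NormedSpace
open scoped Manifold ContDiff

set_option linter.unusedSectionVars false

section LeviCivita

variable {E : Type*} [NormedAddCommGroup E] [NormedSpace ℝ E]
  {H : Type*} [TopologicalSpace H] {I : ModelWithCorners ℝ E H}
  {M : Type*} [TopologicalSpace M] [ChartedSpace H M]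
  [RiemannianBundle (fun x : M => TangentSpace I x)]

theorem finiteDimensional_tangentSpace [FiniteDimensional ℝ E] (x : M) :
    FiniteDimensional ℝ (TangentSpace I x) :=
  inferInstanceAs (FiniteDimensional ℝ E)

/-- The inner product of two vector fields, as a function on the manifold. -/
noncomputable def innerField (X Y : Π x : M, TangentSpace I x) (x : M) : ℝ := inner ℝ (X x) (Y x)

theorem innerField_comm (X Y : Π x : M, TangentSpace I x) : innerField X Y = innerField Y X :=
  funext fun x => real_inner_comm (Y x) (X x)

theorem innerField_add_left (X X' Y : Π x : M, TangentSpace I x) :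
    innerField (X + X') Y = innerField X Y + innerField X' Y :=
  funext fun x => inner_add_left (X x) (X' x) (Y x)

theorem innerField_smul_left (f : M → ℝ) (X Y : Π x : M, TangentSpace I x) :
    innerField (f • X) Y = f * innerField X Y :=
  funext fun x => real_inner_smul_left (X x) (Y x) (f x)

/-- The vector `α^♯` that represents a linear functional `α` through the scalar product. -/
noncomputable def sharp [FiniteDimensional ℝ E] {x : M} (α : TangentSpace I x →L[ℝ] ℝ) : TangentSpace I x :=
  haveI := finiteDimensional_tangentSpace (I := I) x
  haveI := FiniteDimensional.complete ℝ (TangentSpace I x)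
  (InnerProductSpace.toDual ℝ (TangentSpace I x)).symm α

theorem inner_sharp [FiniteDimensional ℝ E] {x : M} (α : TangentSpace I x →L[ℝ] ℝ) (v : TangentSpace I x) :
    inner ℝ (sharp α) v = α v :=
  haveI := finiteDimensional_tangentSpace (I := I) x
  haveI := FiniteDimensional.complete ℝ (TangentSpace I x)
  InnerProductSpace.toDual_symm_apply

/-- Half of the right-hand side of the Koszul formula for `⟨∇_X Y, Z⟩`. -/
noncomputable def koszul (Y X Z : Π x : M, TangentSpace I x) (x : M) : ℝ :=
  (d% (innerField Y Z) x (X x) + d% (innerField X Z) x (Y x) - d% (innerField X Y) x (Z x)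
    + inner ℝ (mlieBracket I X Y x) (Z x)
    - inner ℝ (mlieBracket I X Z x) (Y x)
    - inner ℝ (mlieBracket I Y Z x) (X x)) / 2

variable [IsManifold I ∞ M]
  [IsContMDiffRiemannianBundle I ∞ E (fun x : M => TangentSpace I x)]

theorem mdifferentiableAt_innerField {X Y : Π x : M, TangentSpace I x} {x : M}
    (hX : MDiffAt (T% X) x) (hY : MDiffAt (T% Y) x) : MDiffAt (innerField X Y) x :=
  MDifferentiableAt.inner_bundle (E := fun x : M => TangentSpace I x) (b := fun x => x) hX hY

theorem mvfderiv_innerField_smul_left {f : M → ℝ} {X Y : Π x : M, TangentSpace I x} {x : M}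
    (hf : MDiffAt f x) (hX : MDiffAt (T% X) x) (hY : MDiffAt (T% Y) x)
    (v : TangentSpace I x) : d% (innerField (f • X) Y) x v =
      f x * d% (innerField X Y) x v + inner ℝ (X x) (Y x) * d% f x v := by
  rw [innerField_smul_left, mvfderiv_mul hf (mdifferentiableAt_innerField hX hY)]
  rfl

theorem mvfderiv_innerField_smul_right {f : M → ℝ} {X Y : Π x : M, TangentSpace I x} {x : M}
    (hf : MDiffAt f x) (hX : MDiffAt (T% X) x) (hY : MDiffAt (T% Y) x)
    (v : TangentSpace I x) : d% (innerField X (f • Y)) x v =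
      f x * d% (innerField X Y) x v + inner ℝ (X x) (Y x) * d% f x v := by
  rw [innerField_comm, mvfderiv_innerField_smul_left hf hY hX, innerField_comm, real_inner_comm]

theorem mvfderiv_innerField_add_left {X X' Y : Π x : M, TangentSpace I x} {x : M}
    (hX : MDiffAt (T% X) x) (hX' : MDiffAt (T% X') x) (hY : MDiffAt (T% Y) x)
    (v : TangentSpace I x) : d% (innerField (X + X') Y) x v =
      d% (innerField X Y) x v + d% (innerField X' Y) x v := by
  rw [innerField_add_left, mvfderiv_add (mdifferentiableAt_innerField hX hY)
    (mdifferentiableAt_innerField hX' hY)]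
  rfl

theorem mvfderiv_innerField_add_right {X Y Y' : Π x : M, TangentSpace I x} {x : M}
    (hX : MDiffAt (T% X) x) (hY : MDiffAt (T% Y) x) (hY' : MDiffAt (T% Y') x)
    (v : TangentSpace I x) : d% (innerField X (Y + Y')) x v =
      d% (innerField X Y) x v + d% (innerField X Y') x v := by
  rw [innerField_comm, mvfderiv_innerField_add_left hY hY' hX, innerField_comm Y X,
    innerField_comm Y' X]

variable [FiniteDimensional ℝ E]

theorem koszul_tensorial_left {Y Z : Π x : M, TangentSpace I x} {x : M}
    (hY : MDiffAt (T% Y) x) (hZ : MDiffAt (T% Z) x) :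
    TensorialAt I E (fun X => koszul Y X Z x) x where
  smul {f X} hf hX := by
    have := FiniteDimensional.complete ℝ E
    simp only [koszul]
    rw [mvfderiv_innerField_smul_left hf hX hZ, mvfderiv_innerField_smul_left hf hX hY,
      mlieBracket_smul_left hf hX, mlieBracket_smul_left hf hX]
    simp only [Pi.smul_apply', map_smul, inner_add_left, real_inner_smul_left,
      real_inner_smul_right, smul_eq_mul]
    ring
  add {X X'} hX hX' := by
    have := FiniteDimensional.complete ℝ E
    simp only [koszul]
    rw [mvfderiv_innerField_add_left hX hX' hZ, mvfderiv_innerField_add_left hX hX' hY,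
      mlieBracket_add_left hX hX', mlieBracket_add_left hX hX']
    simp only [Pi.add_apply, map_add, inner_add_left, inner_add_right]
    ring

theorem koszul_tensorial_right {Y X : Π x : M, TangentSpace I x} {x : M}
    (hY : MDiffAt (T% Y) x) (hX : MDiffAt (T% X) x) :
    TensorialAt I E (fun Z => koszul Y X Z x) x where
  smul {f Z} hf hZ := by
    have := FiniteDimensional.complete ℝ E
    simp only [koszul]
    rw [mvfderiv_innerField_smul_right hf hX hZ, mvfderiv_innerField_smul_right hf hY hZ,
      mlieBracket_smul_right hf hZ, mlieBracket_smul_right hf hZ]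
    simp only [Pi.smul_apply', map_smul, inner_add_left, real_inner_smul_left,
      real_inner_smul_right, smul_eq_mul, real_inner_comm]
    ring
  add {Z Z'} hZ hZ' := by
    have := FiniteDimensional.complete ℝ E
    simp only [koszul]
    rw [mvfderiv_innerField_add_right hX hZ hZ', mvfderiv_innerField_add_right hY hZ hZ',
      mlieBracket_add_right hZ hZ', mlieBracket_add_right hZ hZ']
    simp only [Pi.add_apply, map_add, inner_add_left, inner_add_right]
    ring

theorem koszul_add {Y Y' X Z : Π x : M, TangentSpace I x} {x : M}
    (hY : MDiffAt (T% Y) x) (hY' : MDiffAt (T% Y') x) (hX : MDiffAt (T% X) x)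
    (hZ : MDiffAt (T% Z) x) : koszul (Y + Y') X Z x = koszul Y X Z x + koszul Y' X Z x := by
  have := FiniteDimensional.complete ℝ E
  simp only [koszul]
  rw [mvfderiv_innerField_add_left hY hY' hZ, mvfderiv_innerField_add_right hX hY hY',
    mlieBracket_add_left hY hY', mlieBracket_add_right hY hY']
  simp only [Pi.add_apply, map_add, inner_add_left, inner_add_right]
  ring

theorem koszul_smul {f : M → ℝ} {Y X Z : Π x : M, TangentSpace I x} {x : M}
    (hf : MDiffAt f x) (hY : MDiffAt (T% Y) x) (hX : MDiffAt (T% X) x)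
    (hZ : MDiffAt (T% Z) x) :
    koszul (f • Y) X Z x = f x * koszul Y X Z x + d% f x (X x) * inner ℝ (Y x) (Z x) := by
  have := FiniteDimensional.complete ℝ E
  simp only [koszul]
  rw [mvfderiv_innerField_smul_left hf hY hZ, mvfderiv_innerField_smul_right hf hX hY,
    mlieBracket_smul_left hf hY, mlieBracket_smul_right hf hY]
  simp only [Pi.smul_apply', map_smul, inner_add_left, real_inner_smul_left,
      real_inner_smul_right, smul_eq_mul]
  rw [real_inner_comm (X x) (Y x)]
  ring

/-- The Koszul functional `(X, Z) ↦ koszul Y X Z x` as a bilinear form on the tangent space. -/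
noncomputable def koszulForm {Y : Π x : M, TangentSpace I x} {x : M} (hY : MDiffAt (T% Y) x) :
    TangentSpace I x →L[ℝ] TangentSpace I x →L[ℝ] ℝ :=
  TensorialAt.mkHom₂ (fun X Z => koszul Y X Z x) x
    (fun _ hZ => koszul_tensorial_left hY hZ) (fun _ hX => koszul_tensorial_right hY hX)

theorem koszulForm_apply {Y X Z : Π x : M, TangentSpace I x} {x : M}
    (hY : MDiffAt (T% Y) x) (hX : MDiffAt (T% X) x) (hZ : MDiffAt (T% Z) x) :
    koszulForm hY (X x) (Z x) = koszul Y X Z x :=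
  TensorialAt.mkHom₂_apply _ _ hX hZ

open Classical in
/-- The map `X ↦ ∇_X Y` at the point `x`, for the Levi-Civita connection `∇`. -/
noncomputable def leviCivitaFun (Y : Π x : M, TangentSpace I x) (x : M) :
    TangentSpace I x →L[ℝ] TangentSpace I x :=
  haveI := finiteDimensional_tangentSpace (I := I) x
  if hY : MDiffAt (T% Y) x then
    LinearMap.toContinuousLinearMap
      { toFun := fun v => sharp (koszulForm hY v)
        map_add' := fun v w => ext_inner_right ℝ fun u => by
          simp [inner_add_left, inner_sharp]
        map_smul' := fun c v => ext_inner_right ℝ fun u => by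
          simp [real_inner_smul_left, inner_sharp] }
  else 0

theorem inner_leviCivitaFun_apply {Y X Z : Π x : M, TangentSpace I x} {x : M}
    (hY : MDiffAt (T% Y) x) (hX : MDiffAt (T% X) x) (hZ : MDiffAt (T% Z) x) :
    inner ℝ (leviCivitaFun Y x (X x)) (Z x) = koszul Y X Z x := by
  rw [← koszulForm_apply hY hX hZ, ← inner_sharp]
  simp only [leviCivitaFun, dif_pos hY]
  rfl

theorem leviCivitaFun_ext {x : M} {A B : TangentSpace I x →L[ℝ] TangentSpace I x}
    (h : ∀ X Z : Π x : M, TangentSpace I x, MDiffAt (T% X) x → MDiffAt (T% Z) x →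
      (inner ℝ (A (X x)) (Z x) : ℝ) = inner ℝ (B (X x)) (Z x)) : A = B := by
  ext v
  refine ext_inner_right ℝ fun w => ?_
  simpa using h (extend E v) (extend E w) (mdifferentiableAt_extend ..)
    (mdifferentiableAt_extend ..)

/-- The Levi-Civita connection of a Riemannian manifold, through the Koszul formula. -/
noncomputable def leviCivita : CovariantDerivative I E (TangentSpace I : M → Type _) where
  toFun := leviCivitaFun
  isCovariantDerivativeOnUniv :=
    { add := fun {Y Y' x} hY hY' _ => leviCivitaFun_ext fun X Z hX hZ => by
        rw [inner_leviCivitaFun_apply (mdifferentiableAt_add_section hY hY') hX hZ,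
          koszul_add hY hY' hX hZ, ← inner_leviCivitaFun_apply hY hX hZ,
          ← inner_leviCivitaFun_apply hY' hX hZ]
        exact (inner_add_left _ _ _).symm
      leibniz := fun {Y f x} hY hf _ => leviCivitaFun_ext fun X Z hX hZ => by
        rw [inner_leviCivitaFun_apply (hf.smul_section hY) hX hZ,
          koszul_smul hf hY hX hZ, ← inner_leviCivitaFun_apply hY hX hZ]
        simp [inner_add_left, real_inner_smul_left] }

/-- The Levi-Civita connection is torsion-free. -/
theorem leviCivita_torsion {X Y : Π x : M, TangentSpace I x} {x : M}
    (hX : MDiffAt (T% X) x) (hY : MDiffAt (T% Y) x) :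
    leviCivita Y x (X x) - leviCivita X x (Y x) = mlieBracket I X Y x := by
  refine ext_inner_right ℝ fun w => ?_
  have hw : MDiffAt (T% (extend E w)) x := mdifferentiableAt_extend I E w
  have h1 := inner_leviCivitaFun_apply hY hX hw
  have h2 := inner_leviCivitaFun_apply hX hY hw
  simp only [koszul, extend_apply_self, innerField_comm Y X, mlieBracket_swap_apply (V := Y) (W := X),
    inner_neg_left] at h1 h2
  rw [inner_sub_left]
  refine (congrArg₂ (· - ·) h1 h2).trans ?_
  ring

/-- The Levi-Civita connection is compatible with the metric. -/
theorem leviCivita_metric {X Y Z : Π x : M, TangentSpace I x} {x : M}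
    (hX : MDiffAt (T% X) x) (hY : MDiffAt (T% Y) x) (hZ : MDiffAt (T% Z) x) :
    d% (innerField Y Z) x (X x) =
      inner ℝ (leviCivita Y x (X x)) (Z x) + inner ℝ (Y x) (leviCivita Z x (X x)) := by
  have h1 := inner_leviCivitaFun_apply hY hX hZ
  have h2 := inner_leviCivitaFun_apply hZ hX hY
  rw [real_inner_comm _ (Y x)]
  refine Eq.trans ?_ (congrArg₂ (· + ·) h1 h2).symm
  simp only [koszul, innerField_comm Z Y, mlieBracket_swap_apply (V := Z) (W := Y), inner_neg_left]
  ring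

end LeviCivita

section Connection

variable {E : Type*} [NormedAddCommGroup E] [NormedSpace ℝ E] [FiniteDimensional ℝ E]
  {H : Type*} [TopologicalSpace H] {I : ModelWithCorners ℝ E H}
  {M : Type*} [TopologicalSpace M] [ChartedSpace H M] [IsManifold I ∞ M]
  [RiemannianBundle (fun x : M => TangentSpace I x)]

/-- Smoothness of a differential `3`-form: it is smooth on smooth (local) vector fields. -/
def IsSmoothThreeForm (T : Π x : M, TangentSpace I x [⋀^Fin 3]→L[ℝ] ℝ) : Prop :=
  ∀ (x : M) (X Y Z : Π y : M, TangentSpace I y),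
    CMDiffAt ∞ (T% X) x → CMDiffAt ∞ (T% Y) x → CMDiffAt ∞ (T% Z) x →
    CMDiffAt ∞ (fun y => T y ![X y, Y y, Z y]) x

/-- The linear functional `T(X, Y, ·)`. -/
noncomputable def insertTwo {x : M} (T : TangentSpace I x [⋀^Fin 3]→L[ℝ] ℝ) (X Y : TangentSpace I x) :
    TangentSpace I x →L[ℝ] ℝ :=
  T.toContinuousMultilinearMap.toContinuousLinearMap ![X, Y, 0] 2

theorem insertTwo_apply {x : M} (T : TangentSpace I x [⋀^Fin 3]→L[ℝ] ℝ)
    (X Y Z : TangentSpace I x) : insertTwo T X Y Z = T ![X, Y, Z] := by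
  have h : Function.update ![X, Y, 0] 2 Z = ![X, Y, Z] := by
    funext i
    fin_cases i <;> rfl
  exact congrArg T h

/-- The connection `cov` has vectorial torsion component `V`, totally anti-symmetric torsion
component `T` and no Cartan type torsion:
`∇_X Y = ∇^g_X Y + ⟨X, Y⟩ V - ⟨V, Y⟩ X + T(X, Y, ·)^♯`. -/
def HasTorsionComponents
    [IsContMDiffRiemannianBundle I ∞ E (fun x : M => TangentSpace I x)]
    (cov : CovariantDerivative I E (TangentSpace I : M → Type _))
    (V : Π x : M, TangentSpace I x)
    (T : Π x : M, TangentSpace I x [⋀^Fin 3]→L[ℝ] ℝ) : Prop :=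
  ∀ (Y : Π x : M, TangentSpace I x) (x : M) (X : TangentSpace I x), MDiffAt (T% Y) x →
    cov Y x X = leviCivita Y x X + (inner ℝ X (Y x) : ℝ) • V x - (inner ℝ (V x) (Y x) : ℝ) • X
      + sharp (insertTwo (T x) X (Y x))

/-- The curvature operator `∇_X ∇_Y Z - ∇_Y ∇_X Z - ∇_{[X, Y]} Z` on vector fields.
Note that `cov Y x (X x)` is `∇_X Y` at `x`. -/
noncomputable def curvatureField (cov : CovariantDerivative I E (TangentSpace I : M → Type _))
    (X Y Z : Π x : M, TangentSpace I x) (x : M) : TangentSpace I x :=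
  cov (fun y => cov Z y (Y y)) x (X x) - cov (fun y => cov Z y (X y)) x (Y x)
    - cov Z x (mlieBracket I X Y x)

/-- The curvature tensor `riem(X, Y, Z, W) = ⟨Riem(X, Y) Z, W⟩` at the point `x`; the tangent
vectors `X`, `Y`, `Z` are extended to vector fields that are smooth near `x`. -/
noncomputable def riem (cov : CovariantDerivative I E (TangentSpace I : M → Type _)) (x : M)
    (X Y Z W : TangentSpace I x) : ℝ :=
  inner ℝ (curvatureField cov (extend E X) (extend E Y) (extend E Z) x) W

end Connection

section Tensors

variable {U : Type*} [NormedAddCommGroup U] [InnerProductSpace ℝ U] {ι : Type*} [Fintype ι]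

/-- The scalar product `g` of `U` as a `(2,0)`-tensor. -/
def metricTensor (X Y : U) : ℝ := inner ℝ X Y

/-- The (generalised) Kulkarni-Nomizu product of two `(2,0)`-tensors. -/
def kulkarniNomizu (h k : U → U → ℝ) (X Y Z W : U) : ℝ :=
  h X Z * k Y W + h Y W * k X Z - h X W * k Y Z - h Y Z * k X W

/-- The `g`-trace of a `(2,0)`-tensor, computed in the orthonormal basis `e`. -/
noncomputable def traceTensor (e : OrthonormalBasis ι ℝ U) (k : U → U → ℝ) : ℝ := ∑ i, k (e i) (e i)

/-- The Ricci contraction of a `(4,0)`-tensor, computed in the orthonormal basis `e`. -/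
noncomputable def ricciContraction (e : OrthonormalBasis ι ℝ U) (Q : U → U → U → U → ℝ) (X Y : U) : ℝ :=
  ∑ i, Q (e i) X Y (e i)

/-- The Bianchi map. -/
noncomputable def bianchi (Q : U → U → U → U → ℝ) (X Y Z W : U) : ℝ :=
  (Q X Y Z W + Q Y Z X W + Q Z X Y W) / 3

/-- The component `Q - b(Q)` of `Q` in the kernel of the Bianchi map `b`. -/
noncomputable def bianchiKer (Q : U → U → U → U → ℝ) (X Y Z W : U) : ℝ :=
  Q X Y Z W - bianchi Q X Y Z W

/-- The symmetrisation of a `(4,0)`-tensor with respect to the exchange of the two pairs. -/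
noncomputable def pairSymm (Q : U → U → U → U → ℝ) (X Y Z W : U) : ℝ :=
  (Q X Y Z W + Q Z W X Y) / 2

/-- The symmetric part of a `(2,0)`-tensor. -/
noncomputable def symmPart (k : U → U → ℝ) (X Y : U) : ℝ := (k X Y + k Y X) / 2

/-- Algebraic curvature tensors: multilinear, anti-symmetric in the first and in the last pair,
symmetric in the exchange of the pairs, and in the kernel of the Bianchi map. -/
structure IsAlgebraicCurvatureTensor (Q : U → U → U → U → ℝ) : Prop where
  multilinear : ∃ P : MultilinearMap ℝ (fun _ : Fin 4 => U) ℝ,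
    ∀ X Y Z W, Q X Y Z W = P ![X, Y, Z, W]
  antisymm_left : ∀ X Y Z W, Q X Y Z W = -Q Y X Z W
  antisymm_right : ∀ X Y Z W, Q X Y Z W = -Q X Y W Z
  pair_symm : ∀ X Y Z W, Q X Y Z W = Q Z W X Y
  bianchi_eq_zero : ∀ X Y Z W, bianchi Q X Y Z W = 0

/-- The algebraic scalar curvature `s(Q)`. -/
noncomputable def scalarPart (e : OrthonormalBasis ι ℝ U) (Q : U → U → U → U → ℝ) : ℝ :=
  traceTensor e (ricciContraction e Q)

/-- The algebraic tracefree Ricci curvature `h(Q) = c(Q) - s(Q)/n g`. -/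
noncomputable def tracefreeRicci (e : OrthonormalBasis ι ℝ U) (Q : U → U → U → U → ℝ)
    (X Y : U) : ℝ :=
  ricciContraction e Q X Y - scalarPart e Q / Fintype.card ι * metricTensor X Y

/-- The algebraic Weyl tensor
`weyl(Q) = Q + 1/(n-2) h(Q) ∧ g + s(Q)/(2n(n-1)) g ∧ g`, with `∧` the Kulkarni-Nomizu product. -/
noncomputable def weyl (e : OrthonormalBasis ι ℝ U) (Q : U → U → U → U → ℝ) (X Y Z W : U) : ℝ :=
  let n : ℝ := Fintype.card ι
  Q X Y Z W + 1 / (n - 2) * kulkarniNomizu (tracefreeRicci e Q) metricTensor X Y Z W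
    + 1 / (2 * n * (n - 1)) * scalarPart e Q * kulkarniNomizu metricTensor metricTensor X Y Z W

/-- The norm of a `(2,0)`-tensor, computed in the orthonormal basis `e`. -/
noncomputable def tensorNorm₂ (e : OrthonormalBasis ι ℝ U) (k : U → U → ℝ) : ℝ :=
  √(∑ i, ∑ j, k (e i) (e j) ^ 2)

/-- The norm of a `(4,0)`-tensor, computed in the orthonormal basis `e`. -/
noncomputable def tensorNorm₄ (e : OrthonormalBasis ι ℝ U) (Q : U → U → U → U → ℝ) : ℝ :=
  √(∑ i, ∑ j, ∑ k, ∑ l, Q (e i) (e j) (e k) (e l) ^ 2)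

end Tensors

/-! ### Differentiating functions along vector fields -/

section Smoothness

open Filter Topology

variable {E : Type*} [NormedAddCommGroup E] [NormedSpace ℝ E]
  {H : Type*} [TopologicalSpace H] {I : ModelWithCorners ℝ E H}
  {M : Type*} [TopologicalSpace M] [ChartedSpace H M]

/-! Write ∇ = ∇^g + A with A = `torsionOp`. Then riem is riem^g plus the antisymmetrised covariant
derivative of A plus the commutator of A with itself (`HasTorsionComponents.riem_eq`). The additive
map Q ↦ `bianchiKer (pairSymm Q)` fixes riem^g, and the remaining terms are sorted by type. The
terms in ∇T, and the products of V with T, become 4-forms after pair symmetrisation; the Bianchi map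
b fixes 4-forms, so they disappear. The terms in ∇V and those quadratic in V become products φ ∧ g
with φ symmetric (∧ denotes the Kulkarni-Nomizu product). The terms quadratic in T are where
dimension four matters for the Weyl tensor: T is the contraction of the volume form with a vector θ,
so ⟨T(a,b,·), T(c,d,·)⟩ is the Gram determinant of θ, a, b against θ, c, d
(`exists_gram_threeForm`), and this is again some φ ∧ g. Altogether riem^S_ker = riem^g + φ ∧ g
(`HasTorsionComponents.exists_bianchiKer_pairSymm_riem`).

The Weyl map does not see φ ∧ g (`weyl_add_kulkarniNomizu`), which gives the equality of Weyl
tensors. The norm formula is algebra: φ ↦ φ ∧ g is, up to the factor -4, adjoint to the Ricci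
contraction (`sum_mul_kulkarniNomizu`), which yields the formula for any algebraic curvature tensor;
for riem^S_ker the contraction is ric^S because riem is anti-symmetric in both pairs.

Tensoriality of the curvature is never shown directly. Its symmetries and its evident linearity in
the last entry suffice (`isAlgebraicCurvatureTensor_of_symmetries`). -/

theorem two_lt_infty : (2 : ℕ∞ω) < ∞ :=
  WithTop.coe_lt_coe.2 (ENat.natCast_lt_top 2)

theorem two_le_infty : (2 : ℕ∞ω) ≤ ∞ := two_lt_infty.le

theorem one_le_infty : (1 : ℕ∞ω) ≤ ∞ :=
  WithTop.coe_le_coe.2 (le_top : (1 : ℕ∞) ≤ ⊤)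

theorem contMDiffAt_det {ι : Type*} [Fintype ι] [DecidableEq ι] {n : ℕ∞ω} {x : M}
    {A : M → Matrix ι ι ℝ} (h : ∀ i j, CMDiffAt n (fun y => A y i j) x) :
    CMDiffAt n (fun y => (A y).det) x := by
  simp only [Matrix.det_apply']
  refine contMDiffAt_finsetSum fun σ _ => contMDiffAt_const.mul ?_
  exact contMDiffAt_finsetProd fun i _ => h _ _

variable [IsManifold I ∞ M]

/-- The derivative of a `C^n` function along a `C^m` vector field is `C^m`, if `m + 1 ≤ n`. -/
theorem ContMDiffAt.mvfderiv_apply {f : M → ℝ} {Y : Π x : M, TangentSpace I x} {x : M}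
    {m n : ℕ∞ω} [IsManifold I 1 M] [IsManifold I n M] (hf : CMDiffAt n f x)
    (hY : CMDiffAt m (T% Y) x)
    (hmn : m + 1 ≤ n) : CMDiffAt m (fun y => d% f y (Y y)) x := by
  have h := ContMDiffAt.clm_apply_of_inCoordinates
    (E₁ := fun x : M => TangentSpace I x)
    (E₂ := fun t : ℝ => TangentSpace 𝓘(ℝ, ℝ) t) (b₁ := id) (b₂ := f)
    (hf.mfderiv_const hmn) hY (hf.of_le (le_self_add.trans hmn))
  exact (contMDiff_snd_tangentBundle_modelSpace ℝ 𝓘(ℝ, ℝ)).contMDiffAt.comp x h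

/-- Smoothness at a point spreads to a neighbourhood only at an order other than `∞`. This is why
the Levi-Civita lemmas work with C^2 fields. -/
theorem ContMDiffAt.eventually_section {X : Π x : M, TangentSpace I x} {x : M}
    (hX : CMDiffAt 2 (T% X) x) : ∀ᶠ y in 𝓝 x, CMDiffAt 2 (T% X) y := by
  have : IsManifold I 2 M := IsManifold.of_le two_le_infty
  have : IsManifold I (2 + 1) M :=
    IsManifold.of_le (n := ∞) (WithTop.coe_le_coe.2 (le_top : (3 : ℕ∞) ≤ ⊤))
  exact (contMDiffAt_iff_contMDiffAt_nhds two_lt_infty.ne).1 hX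

theorem mvfderiv_congr {f f' : M → ℝ} {x : M} (h : f =ᶠ[𝓝 x] f') : d% f x = d% f' x := by
  ext v
  simp only [mvfderiv]
  rw [h.mfderiv_eq]
  rfl

end Smoothness

/-! ### Regularity of the Levi-Civita derivative -/

section SmoothSections

open Filter Topology Matrix

variable {E : Type*} [NormedAddCommGroup E] [NormedSpace ℝ E] [FiniteDimensional ℝ E]
  {H : Type*} [TopologicalSpace H] {I : ModelWithCorners ℝ E H}
  {M : Type*} [TopologicalSpace M] [ChartedSpace H M] [IsManifold I ∞ M]
  [RiemannianBundle (fun x : M => TangentSpace I x)]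
  [IsContMDiffRiemannianBundle I ∞ E (fun x : M => TangentSpace I x)]

theorem contMDiffAt_innerField {n : ℕ∞ω} (hn : n ≤ ∞) {X Y : Π x : M, TangentSpace I x} {x : M}
    (hX : CMDiffAt n (T% X) x) (hY : CMDiffAt n (T% Y) x) : CMDiffAt n (innerField X Y) x := by
  have : IsContMDiffRiemannianBundle I n E (fun x : M => TangentSpace I x) :=
    IsContMDiffRiemannianBundle.of_le hn
  exact ContMDiffAt.inner_bundle (E := fun x : M => TangentSpace I x) (b := fun x => x) hX hY

/-- Gram's criterion: the Gram matrix of a basis of an inner product space is invertible. -/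
theorem det_gram_ne_zero {ι U : Type*} [Fintype ι] [DecidableEq ι] [NormedAddCommGroup U]
    [InnerProductSpace ℝ U] (b : Module.Basis ι ℝ U) :
    (Matrix.of fun i j => (inner ℝ (b i) (b j) : ℝ)).det ≠ 0 := by
  intro h
  obtain ⟨v, hv, hv0⟩ := Matrix.exists_mulVec_eq_zero_iff.2 h
  refine hv (funext fun i => ?_)
  have h1 : ∀ i, inner ℝ (b i) (∑ j, v j • b j) = (0 : ℝ) := fun i => by
    rw [inner_sum]
    refine Eq.trans ?_ (congrFun hv0 i)
    simp [Matrix.mulVec, dotProduct, real_inner_smul_right, mul_comm]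
  have h2 : ∑ j, v j • b j = 0 := by
    rw [← inner_self_eq_zero (𝕜 := ℝ), sum_inner]
    exact Finset.sum_eq_zero fun i _ => by rw [real_inner_smul_left, h1, mul_zero]
  exact Fintype.linearIndependent_iff.1 b.linearIndependent v h2 i

/-- A vector field is smooth if its scalar products with smooth vector fields are smooth. -/
theorem contMDiffAt_of_inner {n : ℕ∞ω} (hn : n ≤ ∞) {σ : Π x : M, TangentSpace I x} {x : M}
    (h : ∀ Z : Π x : M, TangentSpace I x, CMDiffAt ∞ (T% Z) x →
      CMDiffAt n (innerField σ Z) x) : CMDiffAt n (T% σ) x := by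
  classical
  have hM : IsManifold I n M := IsManifold.of_le hn
  have hV : ContMDiffVectorBundle n E (TangentSpace I : M → Type _) I :=
    ContMDiffVectorBundle.of_le hn
  let t := trivializationAt E (TangentSpace I : M → Type _) x
  have hx : x ∈ t.baseSet := mem_baseSet_trivializationAt' x
  let b := Module.finBasis ℝ E
  let s := t.localFrame b
  have hs : ∀ i, CMDiffAt ∞ (T% (s i)) x := fun i => contMDiffAt_localFrame_of_mem _ _ b i hx
  have hsn : ∀ i, CMDiffAt n (T% (s i)) x := fun i => (hs i).of_le hn
  let G : M → Matrix _ _ ℝ := fun y => Matrix.of fun i j => innerField (s i) (s j) y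
  let r : M → Fin (Module.finrank ℝ E) → ℝ := fun y i => innerField σ (s i) y
  have hG : ∀ y (hy : y ∈ t.baseSet), G y =
      Matrix.of fun i j => (inner ℝ (t.basisAt b hy i) (t.basisAt b hy j) : ℝ) := fun y hy => by
    ext i j
    simp [G, s, innerField, t.localFrame_apply_of_mem_baseSet b hy]
  have hdet : ∀ y ∈ t.baseSet, (G y).det ≠ 0 := fun y hy => by
    rw [hG y hy]
    exact det_gram_ne_zero (t.basisAt b hy)
  -- The coefficients of `σ` in the local frame solve the linear system with the Gram matrix `G` and
  -- right-hand side `r`. Cramer's rule writes them as quotients of determinants of regular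
  -- functions.
  have hσ : ∀ y ∈ t.baseSet,
      σ y = ∑ i, ((G y).cramer (r y) i / (G y).det) • s i y := fun y hy => by
    have h1 : ∀ i, (G y).cramer (r y) i = (G y).det * (t.basisAt b hy).repr (σ y) i := by
      have h2 : G y *ᵥ (fun i => (t.basisAt b hy).repr (σ y) i) = r y := by
        ext i
        simp only [r, innerField, Matrix.mulVec, dotProduct]
        conv_rhs => rw [← (t.basisAt b hy).sum_repr (σ y), sum_inner]
        refine Finset.sum_congr rfl fun j _ => ?_
        simp [G, s, innerField, t.localFrame_apply_of_mem_baseSet b hy, real_inner_smul_right,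
          mul_comm, real_inner_comm]
      intro i
      rw [Matrix.cramer_eq_adjugate_mulVec, ← h2, Matrix.mulVec_mulVec, Matrix.adjugate_mul,
        Matrix.smul_mulVec, Matrix.one_mulVec]
      rfl
    conv_lhs => rw [← (t.basisAt b hy).sum_repr (σ y)]
    refine Finset.sum_congr rfl fun i _ => ?_
    rw [h1, mul_div_cancel_left₀ _ (hdet y hy)]
    simp [s, t.localFrame_apply_of_mem_baseSet b hy]
  have hGs : ∀ i j, CMDiffAt n (fun y => G y i j) x := fun i j =>
    contMDiffAt_innerField hn (hsn i) (hsn j)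
  have key : CMDiffAt n
      (T% (fun y => ∑ i, ((G y).cramer (r y) i / (G y).det) • s i y)) x := by
    refine ContMDiffAt.sum_section fun i _ => ContMDiffAt.smul_section
      (ContMDiffAt.div₀ ?_ (contMDiffAt_det hGs) (hdet x hx)) (hsn i)
    simp only [Matrix.cramer_apply]
    refine contMDiffAt_det fun k l => ?_
    simp only [Matrix.updateCol_apply]
    split_ifs
    · exact h _ (hs k)
    · exact hGs k l
  refine key.congr_of_eventuallyEq ?_
  filter_upwards [t.open_baseSet.mem_nhds hx] with y hy
  rw [hσ y hy]

theorem contMDiffAt_koszul {X Y Z : Π x : M, TangentSpace I x} {x : M}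
    (hX : CMDiffAt 2 (T% X) x) (hY : CMDiffAt 2 (T% Y) x) (hZ : CMDiffAt 2 (T% Z) x) :
    CMDiffAt 1 (koszul Y X Z) x := by
  have := FiniteDimensional.complete ℝ E
  have h2 := two_le_infty
  have h12 : (1 : ℕ∞ω) + 1 ≤ 2 := by norm_num
  have h1 : (1 : ℕ∞ω) ≤ 2 := by norm_num
  have hM : IsManifold I 2 M := IsManifold.of_le h2
  have hM1 : IsManifold I 1 M := IsManifold.of_le (n := 2) h1
  have hM3 : IsManifold I ((2 : ℕ∞) + 1) M := 
    IsManifold.of_le (n := ∞) (WithTop.coe_le_coe.2 (le_top : (3 : ℕ∞) ≤ ⊤))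
  have : IsManifold I (minSmoothness ℝ 2) M := by simpa using hM
  have hd : ∀ {X Y Z : Π x : M, TangentSpace I x}, CMDiffAt 2 (T% X) x → CMDiffAt 2 (T% Y) x →
      CMDiffAt 2 (T% Z) x → CMDiffAt 1 (fun y => d% (innerField X Y) y (Z y)) x :=
    fun hX hY hZ => (contMDiffAt_innerField h2 hX hY).mvfderiv_apply (hZ.of_le h1) h12
  have hb : ∀ {X Y Z : Π x : M, TangentSpace I x}, CMDiffAt 2 (T% X) x → CMDiffAt 2 (T% Y) x →
      CMDiffAt 2 (T% Z) x → CMDiffAt 1 (innerField (mlieBracket I X Y) Z) x :=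
    fun hX hY hZ => contMDiffAt_innerField one_le_infty
      (ContMDiffAt.mlieBracket_vectorField (m := 1) (n := 2) hX hY (by simp; norm_num))
      (hZ.of_le h1)
  exact ((((((hd hY hZ hX).add (hd hX hZ hY)).sub (hd hX hY hZ)).add (hb hX hY hZ)).sub
    (hb hX hZ hY)).sub (hb hY hZ hX)).div_const 2

/-- The scalar products of ∇^g_X Y with smooth fields are Koszul expressions, which lose one
derivative; `contMDiffAt_of_inner` passes from these to the field itself. -/
theorem contMDiffAt_leviCivita {X Y : Π x : M, TangentSpace I x} {x : M}
    (hX : CMDiffAt 2 (T% X) x) (hY : CMDiffAt 2 (T% Y) x) :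
    CMDiffAt 1 (T% (fun y => leviCivita Y y (X y))) x := by
  refine contMDiffAt_of_inner one_le_infty fun Z hZ => ?_
  have hZ2 : CMDiffAt 2 (T% Z) x := hZ.of_le two_le_infty
  refine (contMDiffAt_koszul hX hY hZ2).congr_of_eventuallyEq ?_
  filter_upwards [hX.eventually_section, hY.eventually_section, hZ2.eventually_section]
    with y h1 h2 h3
  exact inner_leviCivitaFun_apply (h2.mdifferentiableAt two_ne_zero)
    (h1.mdifferentiableAt two_ne_zero) (h3.mdifferentiableAt two_ne_zero)

end SmoothSections

/-! ### The Lie bracket as a commutator of derivations -/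

section Bracket

open Filter Topology

variable {E : Type*} [NormedAddCommGroup E] [NormedSpace ℝ E] [FiniteDimensional ℝ E]
  {H : Type*} [TopologicalSpace H] {I : ModelWithCorners ℝ E H}
  {M : Type*} [TopologicalSpace M] [ChartedSpace H M] [IsManifold I ∞ M]

theorem leibniz_mlieBracket {X Y Z : Π x : M, TangentSpace I x} {x : M}
    (hX : CMDiffAt 2 (T% X) x) (hY : CMDiffAt 2 (T% Y) x) (hZ : CMDiffAt 2 (T% Z) x) :
    mlieBracket I X (mlieBracket I Y Z) x =
      mlieBracket I (mlieBracket I X Y) Z x + mlieBracket I Y (mlieBracket I X Z) x := by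
  have := FiniteDimensional.complete ℝ E
  have : IsManifold I (minSmoothness ℝ 3) M := by
    simpa using IsManifold.of_le (n := ∞) (WithTop.coe_le_coe.2 (le_top : (3 : ℕ∞) ≤ ⊤))
  exact leibniz_identity_mlieBracket_apply (by simpa using hX) (by simpa using hY)
    (by simpa using hZ)

theorem contMDiffAt_mlieBracket {X Y : Π x : M, TangentSpace I x} {x : M}
    (hX : CMDiffAt 2 (T% X) x) (hY : CMDiffAt 2 (T% Y) x) :
    CMDiffAt 1 (T% (mlieBracket I X Y)) x := by
  have := FiniteDimensional.complete ℝ E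
  have hM : IsManifold I 2 M := IsManifold.of_le two_le_infty
  have : IsManifold I (minSmoothness ℝ 2) M := by simpa using hM
  have : IsManifold I ((2 : ℕ∞) + 1) M :=
    IsManifold.of_le (n := ∞) (WithTop.coe_le_coe.2 (le_top : (3 : ℕ∞) ≤ ⊤))
  exact ContMDiffAt.mlieBracket_vectorField (m := 1) (n := 2) hX hY (by simp; norm_num)

/-- The Lie bracket is the commutator of the derivations given by two vector fields. -/
theorem mvfderiv_mlieBracket {f : M → ℝ} {X Y : Π x : M, TangentSpace I x} {x : M}
    (hf : CMDiffAt 2 f x) (hX : CMDiffAt 2 (T% X) x) (hY : CMDiffAt 2 (T% Y) x) :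
    d% f x (mlieBracket I X Y x) =
      d% (fun y => d% f y (Y y)) x (X x) - d% (fun y => d% f y (X y)) x (Y x) := by
  rcases subsingleton_or_nontrivial E with hE | hE
  · have h0 : ∀ v : TangentSpace I x, v = 0 := fun v => hE.elim v 0
    rw [h0 (X x), h0 (Y x), h0 (mlieBracket I X Y x)]
    simp
  have := FiniteDimensional.complete ℝ E
  obtain ⟨v, hv⟩ : ∃ v : TangentSpace I x, v ≠ 0 := exists_ne (0 : E)
  have hM : IsManifold I 2 M := IsManifold.of_le two_le_infty
  -- The identity is read off from the Jacobi identity for `X`, `Y`, `f • Z`: after the Jacobi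
  -- identity for `X`, `Y`, `Z` is used, only a multiple of `Z x ≠ 0` is left, whose coefficient is
  -- the claim.
  let Z : Π y : M, TangentSpace I y := extend E v
  have hZ : CMDiffAt 2 (T% Z) x := contMDiffAt_extend I E _
  have hZx : Z x ≠ 0 := by simpa [Z] using hv
  have h12 : (1 : ℕ∞ω) ≤ 2 := one_le_two
  have hd : ∀ {X : Π x : M, TangentSpace I x}, CMDiffAt 2 (T% X) x →
      MDiffAt (fun y => d% f y (X y)) x := fun hX =>
    (hf.mvfderiv_apply (hX.of_le h12) (by norm_num)).mdifferentiableAt one_ne_zero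
  have hm : ∀ {X : Π x : M, TangentSpace I x}, CMDiffAt 2 (T% X) x → MDiffAt (T% X) x :=
    fun hX => hX.mdifferentiableAt two_ne_zero
  have hf1 : MDiffAt f x := hf.mdifferentiableAt two_ne_zero
  have hfe : ∀ᶠ y in 𝓝 x, CMDiffAt 2 f y := (contMDiffAt_iff_contMDiffAt_nhds two_lt_infty.ne).1 hf
  have hfb : ∀ {X Y : Π x : M, TangentSpace I x}, CMDiffAt 2 (T% X) x → CMDiffAt 2 (T% Y) x →
      mlieBracket I X (mlieBracket I Y (f • Z)) x =
      d% (fun y => d% f y (Y y)) x (X x) • Z x + d% f x (Y x) • mlieBracket I X Z x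
        + (d% f x (X x) • mlieBracket I Y Z x + f x • mlieBracket I X (mlieBracket I Y Z) x) := by
    intro X Y hX hY
    have h1 : mlieBracket I Y (f • Z) =ᶠ[𝓝 x]
        (fun y => d% f y (Y y)) • Z + f • mlieBracket I Y Z := by
      filter_upwards [hfe, hZ.eventually_section] with y h1 h2
      rw [mlieBracket_smul_right (h1.mdifferentiableAt two_ne_zero)
        (h2.mdifferentiableAt two_ne_zero)]
      rfl
    have hYZ := (contMDiffAt_mlieBracket hY hZ).mdifferentiableAt one_ne_zero
    rw [(EventuallyEq.refl _ X).mlieBracket_vectorField_eq h1,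
      mlieBracket_add_right ((hd hY).smul_section (hm hZ)) (hf1.smul_section hYZ),
      mlieBracket_smul_right (hd hY) (hm hZ), mlieBracket_smul_right hf1 hYZ]
  have hfZ : CMDiffAt 2 (T% (f • Z)) x := hf.smul_section hZ
  have h := leibniz_mlieBracket hX hY hfZ
  rw [hfb hX hY, hfb hY hX, mlieBracket_smul_right hf1 (hm hZ), leibniz_mlieBracket hX hY hZ] at h
  refine smul_left_injective ℝ hZx ?_
  simp only [sub_smul]
  linear_combination (norm := module) (-1 : ℝ) • h

end Bracket

/-! ### Algebra of curvature tensors and their torsion terms -/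

section CurvatureAlgebra

variable {U : Type*} [NormedAddCommGroup U] [InnerProductSpace ℝ U]

/-- The two anti-symmetries and the Bianchi identity force pair symmetry, and the symmetries then
carry linearity from the last entry to the other three. -/
theorem isAlgebraicCurvatureTensor_of_symmetries {Q : U → U → U → U → ℝ}
    (hadd : ∀ X Y Z W W', Q X Y Z (W + W') = Q X Y Z W + Q X Y Z W')
    (hsmul : ∀ (c : ℝ) X Y Z W, Q X Y Z (c • W) = c * Q X Y Z W)
    (hl : ∀ X Y Z W, Q X Y Z W = -Q Y X Z W) (hr : ∀ X Y Z W, Q X Y Z W = -Q X Y W Z)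
    (hb : ∀ X Y Z W, Q X Y Z W + Q Y Z X W + Q Z X Y W = 0) :
    IsAlgebraicCurvatureTensor Q := by
  have hp : ∀ X Y Z W, Q X Y Z W = Q Z W X Y := fun X Y Z W => by
    -- The classical octahedron argument: combine the four Bianchi identities obtained by rotating
    -- the entries.
    linarith [hb X Y Z W, hb Y Z W X, hb Z W X Y, hb W X Y Z, hr X Y Z W, hr Y Z X W,
      hl Z X Y W, hr X Z Y W, hr Y Z W X, hr Z W Y X, hl W Y Z X, hr Y W Z X, hl W X Z Y,
      hl X Z W Y, hr Z W X Y, hl X W Y Z, hr W X Y Z, hl Y W X Z, hr W Y X Z, hr X Y W Z, hr X W Y Z,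
      hr Z X Y W, hr W X Z Y, hl W X Y Z, hl Y X W Z, hl X Y Z W, hl Z X W Y]
  have ha1 : ∀ X X' Y Z W, Q (X + X') Y Z W = Q X Y Z W + Q X' Y Z W := fun X X' Y Z W => by
    rw [hp, hr, hadd, hp X, hp X', hr Z W X, hr Z W X']; ring
  have ha2 : ∀ X Y Y' Z W, Q X (Y + Y') Z W = Q X Y Z W + Q X Y' Z W := fun X Y Y' Z W => by
    rw [hp, hadd, hp X, hp X]
  have ha3 : ∀ X Y Z Z' W, Q X Y (Z + Z') W = Q X Y Z W + Q X Y Z' W := fun X Y Z Z' W => by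
    rw [hr, hadd, hr X Y Z, hr X Y Z']; ring
  have hs1 : ∀ (c : ℝ) X Y Z W, Q (c • X) Y Z W = c * Q X Y Z W := fun c X Y Z W => by
    rw [hp, hr, hsmul, hp X, hr Z W X]; ring
  have hs2 : ∀ (c : ℝ) X Y Z W, Q X (c • Y) Z W = c * Q X Y Z W := fun c X Y Z W => by
    rw [hp, hsmul, hp X]
  have hs3 : ∀ (c : ℝ) X Y Z W, Q X Y (c • Z) W = c * Q X Y Z W := fun c X Y Z W => by
    rw [hr, hsmul, hr X Y Z]; ring
  refine ⟨⟨MultilinearMap.mk' (fun m => Q (m 0) (m 1) (m 2) (m 3)) ?_ ?_, fun X Y Z W => rfl⟩,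
    hl, hr, hp, fun X Y Z W => by rw [bianchi, hb, zero_div]⟩
  · intro m i a b
    fin_cases i <;> simp [Function.update, ha1, ha2, ha3, hadd]
  · intro m i c a
    fin_cases i <;> simp [Function.update, hs1, hs2, hs3, hsmul]

theorem bianchiKer_pairSymm_add (Q Q' : U → U → U → U → ℝ) (X Y Z W : U) :
    bianchiKer (pairSymm (Q + Q')) X Y Z W =
      bianchiKer (pairSymm Q) X Y Z W + bianchiKer (pairSymm Q') X Y Z W := by
  simp only [bianchiKer, bianchi, pairSymm, Pi.add_apply]
  ring

theorem IsAlgebraicCurvatureTensor.bianchiKer_pairSymm {Q : U → U → U → U → ℝ}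
    (hQ : IsAlgebraicCurvatureTensor Q) (X Y Z W : U) :
    bianchiKer (pairSymm Q) X Y Z W = Q X Y Z W := by
  have h := hQ.bianchi_eq_zero X Y Z W
  simp only [bianchi] at h
  simp only [bianchiKer, bianchi, pairSymm, ← hQ.pair_symm X Y Z W, ← hQ.pair_symm Y Z X W,
    ← hQ.pair_symm Z X Y W]
  linear_combination -h

/-- The antisymmetrised derivative of a `3`-form does not contribute to the curvature tensor. -/
theorem bianchiKer_pairSymm_deriv_eq_zero {D : U → U → U → U → ℝ}
    (h1 : ∀ X Y Z W, D X Y Z W = -D X Z Y W) (h2 : ∀ X Y Z W, D X Y Z W = -D X Y W Z)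
    (X Y Z W : U) :
    bianchiKer (pairSymm fun X Y Z W => D X Y Z W - D Y X Z W) X Y Z W = 0 := by
  -- Pair symmetrisation gives half of the alternating sum of `D` over its first entry, a 4-form.
  -- Cyclic permutations of three entries are even, so b fixes it.
  simp only [bianchiKer, bianchi, pairSymm]
  linarith [h1 X Y Z W, h2 X Y Z W, h1 X W Y Z, h2 X W Y Z, h2 X Z Y W, h1 X Y W Z,
    h1 Y X Z W, h2 Y Z X W, h1 Y W Z X, h2 Y W Z X, h2 Y X Z W, h1 Y X W Z, h1 Y Z W X,
    h1 Z X Y W, h1 Z W X Y, h2 Z X W Y, h2 Z W X Y, h2 Z X Y W,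
    h1 W X Y Z, h2 W X Y Z, h1 W Z X Y, h2 W X Z Y, h1 W Y Z X, h2 W Y X Z]

/-- The tensor is -B ∧ g. Exchanging the pairs transposes B, and the product of a symmetric form
with g lies in the kernel of b. -/
theorem bianchiKer_pairSymm_vectorial (B : U → U → ℝ) (X Y Z W : U) :
    bianchiKer (pairSymm fun X Y Z W => inner ℝ Y Z * B X W - B X Z * inner ℝ Y W
      - (inner ℝ X Z * B Y W - B Y Z * inner ℝ X W)) X Y Z W =
    kulkarniNomizu (fun X Y => -symmPart B X Y) metricTensor X Y Z W := by
  simp only [bianchiKer, bianchi, pairSymm, kulkarniNomizu, metricTensor, symmPart,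
    real_inner_comm X Y, real_inner_comm X Z, real_inner_comm X W, real_inner_comm Y Z,
    real_inner_comm Y W, real_inner_comm Z W]
  ring

/-- The terms in ⟨v,Z⟩⟨v,W⟩⟨X,Y⟩ cancel and the tensor equals the product on the right even before
the projection. The 1/2 occurs because g ∧ g counts each term twice. -/
theorem bianchiKer_pairSymm_vectorial_sq (v X Y Z W : U) :
    bianchiKer (pairSymm fun X Y Z W =>
      (inner ℝ Y Z * inner ℝ v X - inner ℝ v Z * inner ℝ X Y) * inner ℝ v W
        - (inner ℝ Y Z * inner ℝ v v - inner ℝ v Z * inner ℝ v Y) * inner ℝ X W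
      - ((inner ℝ X Z * inner ℝ v Y - inner ℝ v Z * inner ℝ Y X) * inner ℝ v W
        - (inner ℝ X Z * inner ℝ v v - inner ℝ v Z * inner ℝ v X) * inner ℝ Y W)) X Y Z W =
    kulkarniNomizu (fun X Y => inner ℝ v v / 2 * inner ℝ X Y - inner ℝ v X * inner ℝ v Y)
      metricTensor X Y Z W := by
  simp only [bianchiKer, bianchi, pairSymm, kulkarniNomizu, metricTensor,
    real_inner_comm X Y, real_inner_comm X Z, real_inner_comm X W, real_inner_comm Y Z,
    real_inner_comm Y W, real_inner_comm Z W]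
  ring

/-- With β = t(v,·,·), the terms containing the metric form β ∧ g, which changes sign under exchange
of the pairs since β is anti-symmetric. The rest symmetrises to minus the wedge product of ⟨v,·⟩ and
t, a 4-form, fixed by b. -/
theorem bianchiKer_pairSymm_mixed {t : U → U → U → ℝ} (h1 : ∀ X Y Z, t X Y Z = -t Y X Z)
    (h2 : ∀ X Y Z, t X Y Z = -t X Z Y) (v X Y Z W : U) :
    bianchiKer (pairSymm fun X Y Z W =>
      t Y Z X * inner ℝ v W - t Y Z v * inner ℝ X W + inner ℝ Y Z * t X v W - inner ℝ v Z * t X Y W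
      - (t X Z Y * inner ℝ v W - t X Z v * inner ℝ Y W + inner ℝ X Z * t Y v W
        - inner ℝ v Z * t Y X W)) X Y Z W = 0 := by
  have hc : ∀ X Y Z, t Y Z X = t X Y Z := fun X Y Z => by rw [h2, h1, neg_neg]
  have hc' : ∀ X Y Z, t Z X Y = t X Y Z := fun X Y Z => by rw [h1, h2, neg_neg]
  have hr : ∀ X Y Z, t Z Y X = -t X Y Z := fun X Y Z => by rw [h1, hc]
  have hr1 : ∀ X Y Z, t Y X Z = -t X Y Z := fun X Y Z => h1 Y X Z
  have hr2 : ∀ X Y Z, t X Z Y = -t X Y Z := fun X Y Z => h2 X Z Y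
  simp only [bianchiKer, bianchi, pairSymm,
    real_inner_comm X Y, real_inner_comm X Z, real_inner_comm X W, real_inner_comm Y Z,
    real_inner_comm Y W, real_inner_comm Z W, hr2 _ _ v,
    hc X Y Z, hc' X Y Z, hr X Y Z, hr1 X Y Z, hr2 X Y Z,
    hc X Y W, hr X Y W, hr1 X Y W, hc' X Z W, hr1 X Z W, hr2 X Z W,
    hc Y Z W, hr Y Z W, hr1 Y Z W,
    hr1 X Y v, hr1 X Z v, hr1 X W v, hr1 Y Z v, hr1 Y W v, hr1 Z W v]
  ring

/-- The right-hand side of `hG` is itself (|θ|²/2 g - θ ⊗ θ) ∧ g. So G has pair symmetry and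
satisfies the Bianchi identity, which turns -G(X,W,Y,Z) + G(Y,W,X,Z) into G(X,Y,Z,W). -/
theorem bianchiKer_pairSymm_gram {G : U → U → U → U → ℝ} {θ : U}
    (hG : ∀ a b c d, G a b c d = inner ℝ θ θ * (inner ℝ a c * inner ℝ b d - inner ℝ a d * inner ℝ b c)
      - inner ℝ θ c * (inner ℝ θ a * inner ℝ b d - inner ℝ a d * inner ℝ θ b)
      + inner ℝ θ d * (inner ℝ θ a * inner ℝ b c - inner ℝ a c * inner ℝ θ b)) (X Y Z W : U) :
    bianchiKer (pairSymm fun X Y Z W => -G X W Y Z - -G Y W X Z) X Y Z W =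
    kulkarniNomizu (fun X Y => inner ℝ θ θ / 2 * inner ℝ X Y - inner ℝ θ X * inner ℝ θ Y)
      metricTensor X Y Z W := by
  simp only [bianchiKer, bianchi, pairSymm, kulkarniNomizu, metricTensor, hG,
    real_inner_comm X Y, real_inner_comm X Z, real_inner_comm X W, real_inner_comm Y Z,
    real_inner_comm Y W, real_inner_comm Z W]
  ring

/-- The four factors on the left are, up to sign, the components of the 3-vectors x ∧ P and x ∧ Q
(exterior product). The identity is ⟨x ∧ P, x ∧ Q⟩ = |x|²⟨P,Q⟩ - ⟨ι_x P, ι_x Q⟩. -/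
theorem sum_mul_contraction (x : Fin 4 → ℝ) {P Q : Fin 4 → Fin 4 → ℝ}
    (hP : ∀ i j, P i j = -P j i) (hQ : ∀ i j, Q i j = -Q j i) :
    (-x 3 * P 1 2 + x 2 * P 1 3 - x 1 * P 2 3)
      * (-x 3 * Q 1 2 + x 2 * Q 1 3 - x 1 * Q 2 3) +
    (x 3 * P 0 2 - x 2 * P 0 3 + x 0 * P 2 3)
      * (x 3 * Q 0 2 - x 2 * Q 0 3 + x 0 * Q 2 3) +
    (-x 3 * P 0 1 + x 1 * P 0 3 - x 0 * P 1 3)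
      * (-x 3 * Q 0 1 + x 1 * Q 0 3 - x 0 * Q 1 3) +
    (x 2 * P 0 1 - x 1 * P 0 2 + x 0 * P 1 2)
      * (x 2 * Q 0 1 - x 1 * Q 0 2 + x 0 * Q 1 2) =
    (x 0 * x 0 + x 1 * x 1 + x 2 * x 2 + x 3 * x 3) * (P 0 1 * Q 0 1 + P 0 2 * Q 0 2
      + P 0 3 * Q 0 3 + P 1 2 * Q 1 2 + P 1 3 * Q 1 3 + P 2 3 * Q 2 3)
    + -∑ i, (∑ j, x j * P j i) * ∑ j, x j * Q j i := by
  have hP0 : ∀ i, P i i = 0 := fun i => by linarith [hP i i]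
  have hQ0 : ∀ i, Q i i = 0 := fun i => by linarith [hQ i i]
  simp only [Fin.sum_univ_four, hP0, hQ0, hP 1 0, hP 2 0, hP 3 0, hP 2 1, hP 3 1, hP 3 2,
    hQ 1 0, hQ 2 0, hQ 3 0, hQ 2 1, hQ 3 1, hQ 3 2]
  ring

/-- In dimension four, a `3`-form is the contraction `det(θ, ·, ·, ·)` of the volume form. The
scalar product of the vectors `t(a, b, ·)` and `t(c, d, ·)` is then a Gram determinant. -/
theorem exists_gram_threeForm (e : OrthonormalBasis (Fin 4) ℝ U) {t : U → U → U → ℝ}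
    (h1 : ∀ X Y Z, t X Y Z = -t Y X Z) (h2 : ∀ X Y Z, t X Y Z = -t X Z Y)
    (hadd : ∀ X X' Y Z, t (X + X') Y Z = t X Y Z + t X' Y Z)
    (hsmul : ∀ (c : ℝ) X Y Z, t (c • X) Y Z = c * t X Y Z) :
    ∃ θ : U, ∀ a b c d, ∑ l, t a b (e l) * t c d (e l) =
      inner ℝ θ θ * (inner ℝ a c * inner ℝ b d - inner ℝ a d * inner ℝ b c)
      - inner ℝ θ c * (inner ℝ θ a * inner ℝ b d - inner ℝ a d * inner ℝ θ b)
      + inner ℝ θ d * (inner ℝ θ a * inner ℝ b c - inner ℝ a c * inner ℝ θ b) := by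
  have hc : ∀ X Y Z, t Y Z X = t X Y Z := fun X Y Z => by rw [h2, h1, neg_neg]
  have hc' : ∀ X Y Z, t Z X Y = t X Y Z := fun X Y Z => by rw [h1, h2, neg_neg]
  have hr : ∀ X Y Z, t Z Y X = -t X Y Z := fun X Y Z => by rw [h1, hc]
  have hr1 : ∀ X Y Z, t Y X Z = -t X Y Z := fun X Y Z => h1 Y X Z
  have hr2 : ∀ X Y Z, t X Z Y = -t X Y Z := fun X Y Z => h2 X Z Y
  have hz1 : ∀ X Z, t X X Z = 0 := fun X Z => by linarith [h1 X X Z]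
  have hz2 : ∀ X Z, t X Z Z = 0 := fun X Z => by linarith [h2 X Z Z]
  have hz3 : ∀ X Z, t X Z X = 0 := fun X Z => by rw [hc, hz1]
  have hadd2 : ∀ X Y Y' Z, t X (Y + Y') Z = t X Y Z + t X Y' Z := fun X Y Y' Z => by
    rw [h1, hadd, h1 X Y, h1 X Y']; ring
  have hsmul2 : ∀ (c : ℝ) X Y Z, t X (c • Y) Z = c * t X Y Z := fun c X Y Z => by
    rw [h1, hsmul, h1 X Y]; ring
  have hx : ∀ x : U, x = inner ℝ (e 0) x • e 0 + inner ℝ (e 1) x • e 1 + inner ℝ (e 2) x • e 2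
      + inner ℝ (e 3) x • e 3 := fun x => by
    conv_lhs => rw [← e.sum_repr' x, Fin.sum_univ_four]
  have hi : ∀ x y : U, (inner ℝ x y : ℝ) = inner ℝ (e 0) x * inner ℝ (e 0) y
      + inner ℝ (e 1) x * inner ℝ (e 1) y + inner ℝ (e 2) x * inner ℝ (e 2) y
      + inner ℝ (e 3) x * inner ℝ (e 3) y := fun x y => by
    rw [← e.sum_inner_mul_inner x y, Fin.sum_univ_four]
    simp only [real_inner_comm x]
  have ht : ∀ a b l, t a b (e l) = ∑ i, ∑ j, inner ℝ (e i) a * inner ℝ (e j) b *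
      t (e i) (e j) (e l) := fun a b l => by
    conv_lhs => rw [hx a, hx b]
    simp only [hadd, hadd2, hsmul, hsmul2, Fin.sum_univ_four]
    ring
  -- Chosen so that t = det(θ,·,·,·) in the basis `e`; the alternating signs come from moving `e i`
  -- to the front of the determinant.
  let θ : U := t (e 1) (e 2) (e 3) • e 0 - t (e 0) (e 2) (e 3) • e 1 + t (e 0) (e 1) (e 3) • e 2
    - t (e 0) (e 1) (e 2) • e 3
  have hθ : inner ℝ (e 0) θ = t (e 1) (e 2) (e 3) ∧ inner ℝ (e 1) θ = -t (e 0) (e 2) (e 3) ∧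
      inner ℝ (e 2) θ = t (e 0) (e 1) (e 3) ∧ inner ℝ (e 3) θ = -t (e 0) (e 1) (e 2) := by
    simp [θ, inner_add_right, inner_sub_right, real_inner_smul_right,
      orthonormal_iff_ite.1 e.orthonormal]
  let x : Fin 4 → ℝ := fun i => inner ℝ (e i) θ
  -- Coordinates of a ∧ b. Below, t(a,b,e_l) is up to sign the component of θ ∧ a ∧ b that omits the
  -- index l.
  let P : U → U → Fin 4 → Fin 4 → ℝ := fun a b i j =>
    inner ℝ (e i) a * inner ℝ (e j) b - inner ℝ (e j) a * inner ℝ (e i) b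
  have hP : ∀ a b i j, P a b i j = -P a b j i := fun a b i j => by simp only [P]; ring
  have ht0 : ∀ a b, t a b (e 0) = -x 3 * P a b 1 2 + x 2 * P a b 1 3 - x 1 * P a b 2 3 := fun a b => by
    rw [ht]
    simp only [Fin.sum_univ_four, hz1, hz2, hz3, 
      hc (e 0) (e 1) (e 2), hr (e 0) (e 1) (e 2), hc (e 0) (e 1) (e 3),
      hr (e 0) (e 1) (e 3), hc (e 0) (e 2) (e 3), hr (e 0) (e 2) (e 3)]
    simp only [x, P, hθ.2.1, hθ.2.2.1, hθ.2.2.2]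
    ring
  have ht1 : ∀ a b, t a b (e 1) = x 3 * P a b 0 2 - x 2 * P a b 0 3 + x 0 * P a b 2 3 := fun a b => by
    rw [ht]
    simp only [Fin.sum_univ_four, hz1, hz2, hz3, 
      hc' (e 0) (e 1) (e 2), hr2 (e 0) (e 1) (e 2), hc' (e 0) (e 1) (e 3),
      hr2 (e 0) (e 1) (e 3), hc (e 1) (e 2) (e 3), hr (e 1) (e 2) (e 3)]
    simp only [x, P, hθ.1, hθ.2.2.1, hθ.2.2.2]
    ring
  have ht2 : ∀ a b, t a b (e 2) = -x 3 * P a b 0 1 + x 1 * P a b 0 3 - x 0 * P a b 1 3 := fun a b => by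
    rw [ht]
    simp only [Fin.sum_univ_four, hz1, hz2, hz3, 
      hr1 (e 0) (e 1) (e 2), hc' (e 0) (e 2) (e 3), hr2 (e 0) (e 2) (e 3),
      hc' (e 1) (e 2) (e 3), hr2 (e 1) (e 2) (e 3)]
    simp only [x, P, hθ.1, hθ.2.1, hθ.2.2.2]
    ring
  have ht3 : ∀ a b, t a b (e 3) = x 2 * P a b 0 1 - x 1 * P a b 0 2 + x 0 * P a b 1 2 := fun a b => by
    rw [ht]
    simp only [Fin.sum_univ_four, hz1, hz2, hz3, 
      hr1 (e 0) (e 1) (e 3), hr1 (e 0) (e 2) (e 3), hr1 (e 1) (e 2) (e 3)]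
    simp only [x, P, hθ.1, hθ.2.1, hθ.2.2.1]
    ring
  have hu : ∀ (i : Fin 4) (a b : U), inner ℝ θ a * inner ℝ (e i) b - inner ℝ θ b * inner ℝ (e i) a =
      ∑ j, x j * P a b j i := fun i a b => by
    rw [hi θ a, hi θ b, Fin.sum_univ_four]
    simp only [x, P]
    ring
  -- Lagrange's identity for the scalar product of a ∧ b and c ∧ d.
  have hg : ∀ a b c d : U, (inner ℝ a c * inner ℝ b d - inner ℝ a d * inner ℝ b c : ℝ) =
      P a b 0 1 * P c d 0 1 + P a b 0 2 * P c d 0 2 + P a b 0 3 * P c d 0 3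
      + P a b 1 2 * P c d 1 2 + P a b 1 3 * P c d 1 3 + P a b 2 3 * P c d 2 3 := fun a b c d => by
    rw [hi a c, hi b d, hi a d, hi b c]
    simp only [P]
    ring
  refine ⟨θ, fun a b c d => ?_⟩
  have hw : - inner ℝ θ c * (inner ℝ θ a * inner ℝ b d - inner ℝ a d * inner ℝ θ b)
      + inner ℝ θ d * (inner ℝ θ a * inner ℝ b c - inner ℝ a c * inner ℝ θ b) =
      -∑ i, (inner ℝ θ a * inner ℝ (e i) b - inner ℝ θ b * inner ℝ (e i) a) *
        (inner ℝ θ c * inner ℝ (e i) d - inner ℝ θ d * inner ℝ (e i) c) := by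
    rw [hi b d, hi a d, hi b c, hi a c, Fin.sum_univ_four]
    ring
  have hr : ∀ x y z w p q : ℝ, x * y - z * p + w * q = x * y + (-z * p + w * q) :=
    fun _ _ _ _ _ _ => by ring
  rw [hr, hw, hg, hi θ θ]
  simp only [hu]
  rw [Fin.sum_univ_four, ht0, ht0, ht1, ht1, ht2, ht2, ht3, ht3]
  exact sum_mul_contraction x (hP a b) (hP c d)

end CurvatureAlgebra

/-! ### Symmetries of the Riemannian curvature tensor -/

section LeviCivitaCurvature

open Filter Topology

variable {E : Type*} [NormedAddCommGroup E] [NormedSpace ℝ E] [FiniteDimensional ℝ E]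
  {H : Type*} [TopologicalSpace H] {I : ModelWithCorners ℝ E H}
  {M : Type*} [TopologicalSpace M] [ChartedSpace H M] [IsManifold I ∞ M]
  [RiemannianBundle (fun x : M => TangentSpace I x)]
  [IsContMDiffRiemannianBundle I ∞ E (fun x : M => TangentSpace I x)]

theorem mdifferentiableAt_leviCivita {X Y : Π x : M, TangentSpace I x} {x : M}
    (hX : CMDiffAt 2 (T% X) x) (hY : CMDiffAt 2 (T% Y) x) :
    MDiffAt (T% (fun y => leviCivita Y y (X y))) x :=
  (contMDiffAt_leviCivita hX hY).mdifferentiableAt one_ne_zero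

theorem mdifferentiableAt_of_contMDiffAt_two {X : Π x : M, TangentSpace I x} {x : M}
    (hX : CMDiffAt 2 (T% X) x) : MDiffAt (T% X) x :=
  hX.mdifferentiableAt two_ne_zero

theorem mvfderiv_mvfderiv_innerField {X Y Z W : Π x : M, TangentSpace I x} {x : M}
    (hX : CMDiffAt 2 (T% X) x) (hY : CMDiffAt 2 (T% Y) x) (hZ : CMDiffAt 2 (T% Z) x)
    (hW : CMDiffAt 2 (T% W) x) :
    d% (fun y => d% (innerField Z W) y (Y y)) x (X x) =
      inner ℝ (leviCivita (fun y => leviCivita Z y (Y y)) x (X x)) (W x)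
      + inner ℝ (leviCivita Z x (Y x)) (leviCivita W x (X x))
      + (inner ℝ (leviCivita Z x (X x)) (leviCivita W x (Y x))
      + inner ℝ (Z x) (leviCivita (fun y => leviCivita W y (Y y)) x (X x))) := by
  have h : (fun y => d% (innerField Z W) y (Y y)) =ᶠ[𝓝 x]
      innerField (fun y => leviCivita Z y (Y y)) W +
        innerField Z (fun y => leviCivita W y (Y y)) := by
    filter_upwards [hY.eventually_section, hZ.eventually_section, hW.eventually_section]
      with y h1 h2 h3
    exact leviCivita_metric (mdifferentiableAt_of_contMDiffAt_two h1)
      (mdifferentiableAt_of_contMDiffAt_two h2) (mdifferentiableAt_of_contMDiffAt_two h3)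
  have hX' := mdifferentiableAt_of_contMDiffAt_two hX
  have hZ' := mdifferentiableAt_of_contMDiffAt_two hZ
  have hW' := mdifferentiableAt_of_contMDiffAt_two hW
  have hYZ := mdifferentiableAt_leviCivita hY hZ
  have hYW := mdifferentiableAt_leviCivita hY hW
  rw [mvfderiv_congr h, mvfderiv_add (mdifferentiableAt_innerField hYZ hW')
    (mdifferentiableAt_innerField hZ' hYW)]
  exact congrArg₂ (· + ·) (leviCivita_metric hX' hYZ hW') (leviCivita_metric hX' hZ' hYW)

/-- The commutator of X and Y acts on ⟨Z,W⟩ as [X,Y]. Expanding both sides by metric compatibility,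
the terms with one derivative on each factor are symmetric in X and Y and cancel. -/
theorem inner_curvatureField_leviCivita_antisymm {X Y Z W : Π x : M, TangentSpace I x} {x : M}
    (hX : CMDiffAt 2 (T% X) x) (hY : CMDiffAt 2 (T% Y) x) (hZ : CMDiffAt 2 (T% Z) x)
    (hW : CMDiffAt 2 (T% W) x) :
    (inner ℝ (curvatureField leviCivita X Y Z x) (W x) : ℝ) =
      -inner ℝ (curvatureField leviCivita X Y W x) (Z x) := by
  have h1 := mvfderiv_mvfderiv_innerField hX hY hZ hW
  have h2 := mvfderiv_mvfderiv_innerField hY hX hZ hW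
  have h3 := mvfderiv_mlieBracket (contMDiffAt_innerField two_le_infty hZ hW) hX hY
  have h4 := leviCivita_metric
    ((contMDiffAt_mlieBracket hX hY).mdifferentiableAt one_ne_zero)
    (mdifferentiableAt_of_contMDiffAt_two hZ) (mdifferentiableAt_of_contMDiffAt_two hW)
  simp only [curvatureField, inner_sub_left, inner_sub_right, real_inner_comm (Z x)]
  linarith

theorem curvatureField_leviCivita_bianchi {X Y Z : Π x : M, TangentSpace I x} {x : M}
    (hX : CMDiffAt 2 (T% X) x) (hY : CMDiffAt 2 (T% Y) x) (hZ : CMDiffAt 2 (T% Z) x) :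
    curvatureField leviCivita X Y Z x + curvatureField leviCivita Y Z X x
      + curvatureField leviCivita Z X Y x = 0 := by
  -- Vanishing torsion, used twice, swaps `Y` and `Z` in ∇_X ∇_Y Z at the cost of brackets. In the
  -- cyclic sum the second derivatives then cancel and the Jacobi identity removes the double
  -- brackets.
  have key : ∀ {X Y Z : Π x : M, TangentSpace I x}, CMDiffAt 2 (T% X) x → CMDiffAt 2 (T% Y) x →
      CMDiffAt 2 (T% Z) x → leviCivita (fun y => leviCivita Z y (Y y)) x (X x) =
        leviCivita (fun y => leviCivita Y y (Z y)) x (X x)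
        + (leviCivita X x (mlieBracket I Y Z x) + mlieBracket I X (mlieBracket I Y Z) x) := by
    intro X Y Z hX hY hZ
    have hYZ := (contMDiffAt_mlieBracket hY hZ).mdifferentiableAt one_ne_zero
    have hZY := mdifferentiableAt_leviCivita hZ hY
    have h : ∀ᶠ y in 𝓝 x, leviCivita Z y (Y y) =
        ((fun y => leviCivita Y y (Z y)) + mlieBracket I Y Z) y := by
      filter_upwards [hY.eventually_section, hZ.eventually_section] with y h1 h2
      rw [Pi.add_apply, ← leviCivita_torsion (mdifferentiableAt_of_contMDiffAt_two h1)
        (mdifferentiableAt_of_contMDiffAt_two h2)]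
      abel
    rw [← leviCivita_torsion (mdifferentiableAt_of_contMDiffAt_two hX) hYZ,
      leviCivita.isCovariantDerivativeOnUniv.congr_of_eventuallyEq
      (mdifferentiableAt_leviCivita hY hZ) (mdifferentiableAt_add_section hZY hYZ) univ_mem h,
      leviCivita.isCovariantDerivativeOnUniv.add hZY hYZ, add_apply]
    abel
  have hj := leibniz_mlieBracket hX hY hZ
  simp only [curvatureField]
  rw [key hX hY hZ, key hY hX hZ, key hZ hX hY, hj, mlieBracket_swap_apply (V := Z) (W := X),
    mlieBracket_swap_apply (V := Z) (W := mlieBracket I X Y), map_neg]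
  abel

theorem isAlgebraicCurvatureTensor_riem_leviCivita (x : M) :
    IsAlgebraicCurvatureTensor (riem (leviCivita (I := I) (M := M)) x) := by
  have hs : ∀ v : TangentSpace I x, CMDiffAt 2 (T% (extend E v)) x :=
    fun v => contMDiffAt_extend I E v
  refine isAlgebraicCurvatureTensor_of_symmetries (fun X Y Z W W' => inner_add_right _ _ _)
    (fun c X Y Z W => real_inner_smul_right _ _ _) (fun X Y Z W => ?_) (fun X Y Z W => ?_)
    (fun X Y Z W => ?_)
  · rw [riem, riem, ← inner_neg_left]
    congr 1
    simp only [curvatureField]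
    rw [mlieBracket_swap_apply, map_neg]
    abel
  · simpa [riem] using inner_curvatureField_leviCivita_antisymm (hs X) (hs Y) (hs Z) (hs W)
  · rw [riem, riem, riem, ← inner_add_left, ← inner_add_left,
      curvatureField_leviCivita_bianchi (hs X) (hs Y) (hs Z), inner_zero_left]

end LeviCivitaCurvature

/-! ### Curvature of the connection with torsion -/

section TorsionCurvature

open Filter Topology

variable {E : Type*} [NormedAddCommGroup E] [NormedSpace ℝ E] [FiniteDimensional ℝ E]
  {H : Type*} [TopologicalSpace H] {I : ModelWithCorners ℝ E H}
  {M : Type*} [TopologicalSpace M] [ChartedSpace H M] [IsManifold I ∞ M]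
  [RiemannianBundle (fun x : M => TangentSpace I x)]
  [IsContMDiffRiemannianBundle I ∞ E (fun x : M => TangentSpace I x)]

/-- The tensor `A(X, Z) = ⟨X, Z⟩ V - ⟨V, Z⟩ X + T(X, Z, ·)^♯`. -/
noncomputable def torsionOp {x : M} (V : TangentSpace I x)
    (T : TangentSpace I x [⋀^Fin 3]→L[ℝ] ℝ) (X Z : TangentSpace I x) : TangentSpace I x :=
  (inner ℝ X Z : ℝ) • V - (inner ℝ V Z : ℝ) • X + sharp (insertTwo T X Z)

theorem inner_torsionOp {x : M} (V : TangentSpace I x)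
    (T : TangentSpace I x [⋀^Fin 3]→L[ℝ] ℝ) (X Z W : TangentSpace I x) :
    inner ℝ (torsionOp V T X Z) W =
      inner ℝ X Z * inner ℝ V W - inner ℝ V Z * inner ℝ X W + T ![X, Z, W] := by
  simp only [torsionOp, inner_add_left, inner_sub_left, real_inner_smul_left, inner_sharp,
    insertTwo_apply]

theorem inner_torsionOp_sub_left {x : M} (V : TangentSpace I x)
    (T : TangentSpace I x [⋀^Fin 3]→L[ℝ] ℝ) (X X' Z W : TangentSpace I x) :
    (inner ℝ (torsionOp V T (X - X') Z) W : ℝ) =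
      inner ℝ (torsionOp V T X Z) W - inner ℝ (torsionOp V T X' Z) W := by
  have h : T ![X - X', Z, W] = T ![X, Z, W] - T ![X', Z, W] := by
    have hu : ∀ Y, Function.update ![X, Z, W] 0 Y = ![Y, Z, W] := fun Y => by
      funext i
      fin_cases i <;> rfl
    simpa only [hu] using T.map_update_sub ![X, Z, W] 0 X X'
  simp only [inner_torsionOp, inner_sub_left, h]
  ring

theorem inner_torsionOp_add_right {x : M} (V : TangentSpace I x)
    (T : TangentSpace I x [⋀^Fin 3]→L[ℝ] ℝ) (X Z Z' W : TangentSpace I x) :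
    (inner ℝ (torsionOp V T X (Z + Z')) W : ℝ) =
      inner ℝ (torsionOp V T X Z) W + inner ℝ (torsionOp V T X Z') W := by
  have h : T ![X, Z + Z', W] = T ![X, Z, W] + T ![X, Z', W] := by
    have hu : ∀ Y, Function.update ![X, Z, W] 1 Y = ![X, Y, W] := fun Y => by
      funext i
      fin_cases i <;> rfl
    simpa only [hu] using T.map_update_add ![X, Z, W] 1 Z Z'
  simp only [inner_torsionOp, inner_add_right, h]
  ring

theorem contMDiffAt_torsionOp {V : Π x : M, TangentSpace I x}
    {T : Π x : M, TangentSpace I x [⋀^Fin 3]→L[ℝ] ℝ} (hT : IsSmoothThreeForm T)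
    {X Z : Π x : M, TangentSpace I x} {x : M} (hV : CMDiffAt ∞ (T% V) x)
    (hX : CMDiffAt ∞ (T% X) x) (hZ : CMDiffAt ∞ (T% Z) x) :
    CMDiffAt ∞ (T% (fun y => torsionOp (V y) (T y) (X y) (Z y))) x := by
  refine contMDiffAt_of_inner le_rfl fun W hW => ?_
  have hi : ∀ {X Y : Π x : M, TangentSpace I x}, CMDiffAt ∞ (T% X) x → CMDiffAt ∞ (T% Y) x →
      CMDiffAt ∞ (innerField X Y) x := fun hX hY => contMDiffAt_innerField le_rfl hX hY
  refine ((((hi hX hZ).mul (hi hV hW)).sub ((hi hV hZ).mul (hi hX hW))).add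
    (hT x X Z W hX hZ hW)).congr_of_eventuallyEq (.of_forall fun y => ?_)
  exact inner_torsionOp _ _ _ _ _

/-- The covariant derivative `(∇_X T)(Y, Z, W)` of a `3`-form. -/
noncomputable def covDerivThreeForm (T : Π x : M, TangentSpace I x [⋀^Fin 3]→L[ℝ] ℝ)
    (X Y Z W : Π x : M, TangentSpace I x) (x : M) : ℝ :=
  d% (fun y => T y ![Y y, Z y, W y]) x (X x) - T x ![leviCivita Y x (X x), Z x, W x]
    - T x ![Y x, leviCivita Z x (X x), W x] - T x ![Y x, Z x, leviCivita W x (X x)]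

theorem swap_left_threeForm {x : M} (T : TangentSpace I x [⋀^Fin 3]→L[ℝ] ℝ)
    (X Y Z : TangentSpace I x) : T ![X, Y, Z] = -T ![Y, X, Z] := by
  have h := T.toAlternatingMap.map_swap ![Y, X, Z] (show (0 : Fin 3) ≠ 1 by decide)
  refine Eq.trans (congrArg T ?_) h
  funext i
  fin_cases i <;> rfl

theorem swap_right_threeForm {x : M} (T : TangentSpace I x [⋀^Fin 3]→L[ℝ] ℝ)
    (X Y Z : TangentSpace I x) : T ![X, Y, Z] = -T ![X, Z, Y] := by
  have h := T.toAlternatingMap.map_swap ![X, Z, Y] (show (1 : Fin 3) ≠ 2 by decide)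
  refine Eq.trans (congrArg T ?_) h
  funext i
  fin_cases i <;> rfl

theorem covDerivThreeForm_swap_left (T : Π x : M, TangentSpace I x [⋀^Fin 3]→L[ℝ] ℝ)
    (X Y Z W : Π x : M, TangentSpace I x) (x : M) :
    covDerivThreeForm T X Y Z W x = -covDerivThreeForm T X Z Y W x := by
  have h : (fun y => T y ![Y y, Z y, W y]) = -fun y => T y ![Z y, Y y, W y] :=
    funext fun y => swap_left_threeForm _ _ _ _
  simp only [covDerivThreeForm, h, mvfderiv_neg, neg_apply]
  rw [swap_left_threeForm (T x) (Y x), swap_left_threeForm (T x) (Y x),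
    swap_left_threeForm (T x) _ (Z x)]
  ring

theorem covDerivThreeForm_swap_right (T : Π x : M, TangentSpace I x [⋀^Fin 3]→L[ℝ] ℝ)
    (X Y Z W : Π x : M, TangentSpace I x) (x : M) :
    covDerivThreeForm T X Y Z W x = -covDerivThreeForm T X Y W Z x := by
  have h : (fun y => T y ![Y y, Z y, W y]) = -fun y => T y ![Y y, W y, Z y] :=
    funext fun y => swap_right_threeForm _ _ _ _
  simp only [covDerivThreeForm, h, mvfderiv_neg, neg_apply]
  rw [swap_right_threeForm (T x) _ (Z x), swap_right_threeForm (T x) _ (Z x),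
    swap_right_threeForm (T x) _ _ (W x)]
  ring

variable {cov : CovariantDerivative I E (TangentSpace I : M → Type _)}
  {V : Π x : M, TangentSpace I x} {T : Π x : M, TangentSpace I x [⋀^Fin 3]→L[ℝ] ℝ}

theorem HasTorsionComponents.apply_eq (hcov : HasTorsionComponents cov V T)
    {Y : Π x : M, TangentSpace I x} {x : M} (hY : MDiffAt (T% Y) x) (X : TangentSpace I x) :
    cov Y x X = leviCivita Y x X + torsionOp (V x) (T x) X (Y x) := by
  rw [hcov Y x X hY, torsionOp]
  abel

/-- The last two summands are ⟨(∇^g_X A)(Y,Z), W⟩. On antisymmetrising in X and Y, the terms A(Y,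
∇_X Z) + A(X, ∇_Y Z) cancel, and A(∇_X Y, Z) is absorbed by the bracket term. -/
theorem HasTorsionComponents.inner_cov_cov (hcov : HasTorsionComponents cov V T)
    (hT : IsSmoothThreeForm T) {X Y Z W : Π x : M, TangentSpace I x} {x : M}
    (hV : CMDiffAt ∞ (T% V) x) (hX : CMDiffAt ∞ (T% X) x) (hY : CMDiffAt ∞ (T% Y) x)
    (hZ : CMDiffAt ∞ (T% Z) x) (hW : CMDiffAt ∞ (T% W) x) :
    inner ℝ (cov (fun y => cov Z y (Y y)) x (X x)) (W x) =
      inner ℝ (leviCivita (fun y => leviCivita Z y (Y y)) x (X x)) (W x)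
      + inner ℝ (torsionOp (V x) (T x) (leviCivita Y x (X x)) (Z x)) (W x)
      + inner ℝ (torsionOp (V x) (T x) (Y x) (leviCivita Z x (X x))) (W x)
      + inner ℝ (torsionOp (V x) (T x) (X x) (leviCivita Z x (Y x))) (W x)
      + inner ℝ (torsionOp (V x) (T x) (X x) (torsionOp (V x) (T x) (Y x) (Z x))) (W x)
      + (inner ℝ (Y x) (Z x) * inner ℝ (leviCivita V x (X x)) (W x)
        - inner ℝ (leviCivita V x (X x)) (Z x) * inner ℝ (Y x) (W x))
      + covDerivThreeForm T X Y Z W x := by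
  have hm : ∀ {X : Π x : M, TangentSpace I x}, CMDiffAt ∞ (T% X) x → MDiffAt (T% X) x :=
    fun hX => hX.mdifferentiableAt (by simp)
  have hZ2 := hZ.of_le two_le_infty
  have hYZ := mdifferentiableAt_leviCivita (hY.of_le two_le_infty) hZ2
  have hA := hm (contMDiffAt_torsionOp hT hV hY hZ)
  have h : ∀ᶠ y in 𝓝 x, cov Z y (Y y) = ((fun y => leviCivita Z y (Y y)) +
      fun y => torsionOp (V y) (T y) (Y y) (Z y)) y := by
    filter_upwards [hZ2.eventually_section] with y hy
    exact hcov.apply_eq (mdifferentiableAt_of_contMDiffAt_two hy) _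
  have hsum := mdifferentiableAt_add_section hYZ hA
  have hσ : MDiffAt (T% (fun y => cov Z y (Y y))) x :=
    hsum.congr_of_eventuallyEq (h.mono fun y hy => congrArg (TotalSpace.mk' E y) hy)
  have hfun : innerField (fun y => torsionOp (V y) (T y) (Y y) (Z y)) W =
      innerField Y Z * innerField V W - innerField V Z * innerField Y W
        + fun y => T y ![Y y, Z y, W y] := funext fun y => inner_torsionOp _ _ _ _ _
  have hi : ∀ {X Y : Π x : M, TangentSpace I x}, CMDiffAt ∞ (T% X) x → CMDiffAt ∞ (T% Y) x →
      MDiffAt (innerField X Y) x := fun hX hY => mdifferentiableAt_innerField (hm hX) (hm hY)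
  have hTd : MDiffAt (fun y => T y ![Y y, Z y, W y]) x :=
    (hT x Y Z W hY hZ hW).mdifferentiableAt (by simp)
  -- The derivative of ⟨A(Y,Z),W⟩ is computed twice, by metric compatibility and by the product rule
  -- applied to the explicit formula; the comparison isolates the derivative of A(Y,Z).
  have hmet := leviCivita_metric (hm hX) hA (hm hW)
  rw [hfun, mvfderiv_add (((hi hY hZ).mul (hi hV hW)).sub ((hi hV hZ).mul (hi hY hW))) hTd,
    mvfderiv_sub ((hi hY hZ).mul (hi hV hW)) ((hi hV hZ).mul (hi hY hW)),
    mvfderiv_mul (hi hY hZ) (hi hV hW), mvfderiv_mul (hi hV hZ) (hi hY hW)] at hmet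
  simp only [add_apply, sub_apply, smul_apply, smul_eq_mul,
    leviCivita_metric (hm hX) (hm hY) (hm hZ), leviCivita_metric (hm hX) (hm hV) (hm hW),
    leviCivita_metric (hm hX) (hm hV) (hm hZ), leviCivita_metric (hm hX) (hm hY) (hm hW)] at hmet
  rw [hcov.apply_eq hσ, leviCivita.isCovariantDerivativeOnUniv.congr_of_eventuallyEq hσ hsum
    univ_mem h, leviCivita.isCovariantDerivativeOnUniv.add hYZ hA, add_apply, inner_add_left,
    inner_add_left, h.self_of_nhds, Pi.add_apply, inner_torsionOp_add_right]
  rw [inner_torsionOp (V x) (T x) (Y x) (Z x)] at hmet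
  rw [inner_torsionOp (V x) (T x) (leviCivita Y x (X x)),
    inner_torsionOp (V x) (T x) (Y x) (leviCivita Z x (X x))]
  simp only [covDerivThreeForm]
  simp only [innerField] at hmet
  linear_combination -hmet

/-- The derivative of `T` stays expressed through the extended fields: only its anti-symmetries are
needed later, not its tensoriality. -/
theorem HasTorsionComponents.riem_eq (hcov : HasTorsionComponents cov V T)
    (hT : IsSmoothThreeForm T) {x : M} (hV : CMDiffAt ∞ (T% V) x) (X Y Z W : TangentSpace I x) :
    riem cov x X Y Z W = riem leviCivita x X Y Z W
      + (covDerivThreeForm T (extend E X) (extend E Y) (extend E Z) (extend E W) x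
        - covDerivThreeForm T (extend E Y) (extend E X) (extend E Z) (extend E W) x)
      + (inner ℝ Y Z * inner ℝ (leviCivita V x X) W - inner ℝ (leviCivita V x X) Z * inner ℝ Y W
        - (inner ℝ X Z * inner ℝ (leviCivita V x Y) W
          - inner ℝ (leviCivita V x Y) Z * inner ℝ X W))
      + (inner ℝ (torsionOp (V x) (T x) X (torsionOp (V x) (T x) Y Z)) W
        - inner ℝ (torsionOp (V x) (T x) Y (torsionOp (V x) (T x) X Z)) W) := by
  have hs : ∀ v : TangentSpace I x, CMDiffAt ∞ (T% (extend E v)) x :=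
    fun v => contMDiffAt_extend I E v
  have h1 := hcov.inner_cov_cov hT hV (hs X) (hs Y) (hs Z) (hs W)
  have h2 := hcov.inner_cov_cov hT hV (hs Y) (hs X) (hs Z) (hs W)
  have h3 := congrArg (inner ℝ · W)
    (hcov.apply_eq ((hs Z).mdifferentiableAt (by simp)) (mlieBracket I (extend E X) (extend E Y) x))
  rw [← leviCivita_torsion ((hs X).mdifferentiableAt (by simp))
    ((hs Y).mdifferentiableAt (by simp))] at h3
  simp only [extend_apply_self, inner_add_left, inner_torsionOp_sub_left] at h1 h2 h3
  simp only [riem, curvatureField, inner_sub_left, extend_apply_self]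
  rw [← leviCivita_torsion ((hs X).mdifferentiableAt (by simp))
    ((hs Y).mdifferentiableAt (by simp))]
  simp only [extend_apply_self]
  linear_combination h1 - h2 - h3

end TorsionCurvature

/-! ### Weyl tensor, Ricci contraction and norms -/

section WeylAlgebra

variable {U : Type*} [NormedAddCommGroup U] [InnerProductSpace ℝ U]

theorem kulkarniNomizu_swap_left (h k : U → U → ℝ) (X Y Z W : U) :
    kulkarniNomizu h k X Y Z W = -kulkarniNomizu h k Y X Z W := by
  simp only [kulkarniNomizu]
  ring

theorem kulkarniNomizu_swap_right (h k : U → U → ℝ) (X Y Z W : U) :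
    kulkarniNomizu h k X Y Z W = -kulkarniNomizu h k X Y W Z := by
  simp only [kulkarniNomizu]
  ring

/-- The Kulkarni-Nomizu product of a symmetric bilinear form with the scalar product is an
algebraic curvature tensor, and so is its sum with such a tensor. -/
theorem IsAlgebraicCurvatureTensor.add_kulkarniNomizu {Q : U → U → U → U → ℝ}
    (hQ : IsAlgebraicCurvatureTensor Q) {φ : U → U → ℝ} (hφ : ∀ X, IsLinearMap ℝ (φ X))
    (hs : ∀ X Y, φ X Y = φ Y X) :
    IsAlgebraicCurvatureTensor fun X Y Z W =>
      Q X Y Z W + kulkarniNomizu φ metricTensor X Y Z W := by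
  obtain ⟨P, hP⟩ := hQ.multilinear
  have hu : ∀ X Y Z W V : U, Function.update ![X, Y, Z, W] 3 V = ![X, Y, Z, V] :=
    fun X Y Z W V => by
      funext i
      fin_cases i <;> rfl
  have ha : ∀ X Y Z W W', Q X Y Z (W + W') = Q X Y Z W + Q X Y Z W' := fun X Y Z W W' => by
    simpa only [hP, hu] using P.map_update_add ![X, Y, Z, W] 3 W W'
  have hm : ∀ (c : ℝ) X Y Z W, Q X Y Z (c • W) = c * Q X Y Z W := fun c X Y Z W => by
    simpa only [hP, hu, smul_eq_mul] using P.map_update_smul ![X, Y, Z, W] 3 c W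
  refine isAlgebraicCurvatureTensor_of_symmetries (fun X Y Z W W' => ?_) (fun c X Y Z W => ?_)
    (fun X Y Z W => ?_) (fun X Y Z W => ?_) (fun X Y Z W => ?_)
  · simp only [kulkarniNomizu, metricTensor, ha, (hφ _).map_add, inner_add_right]
    ring
  · simp only [kulkarniNomizu, metricTensor, hm, (hφ _).map_smul, real_inner_smul_right, smul_eq_mul]
    ring
  · rw [hQ.antisymm_left, kulkarniNomizu_swap_left]
    ring
  · rw [hQ.antisymm_right, kulkarniNomizu_swap_right]
    ring
  · have h := hQ.bianchi_eq_zero X Y Z W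
    simp only [bianchi] at h
    simp only [kulkarniNomizu, metricTensor, hs Y X, hs Z X, hs Z Y, hs X W, hs Y W, hs Z W,
      real_inner_comm X Y, real_inner_comm X Z, real_inner_comm Y Z]
    linear_combination 3 * h

theorem metricTensor_basis {ι : Type*} [Fintype ι] [DecidableEq ι] (e : OrthonormalBasis ι ℝ U)
    (i j : ι) : metricTensor (e i) (e j) = if i = j then 1 else 0 :=
  orthonormal_iff_ite.1 e.orthonormal i j

variable (e : OrthonormalBasis (Fin 4) ℝ U)

/-- The coefficient 2 is n - 2 for n = 4; the minus sign reflects tracing over the first and last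
entries. -/
theorem ricciContraction_kulkarniNomizu {φ : U → U → ℝ} (hφ : ∀ X, IsLinearMap ℝ (φ X))
    (hs : ∀ X Y, φ X Y = φ Y X) (X Y : U) :
    ricciContraction e (kulkarniNomizu φ metricTensor) X Y =
      -(2 * φ X Y + traceTensor e φ * metricTensor X Y) := by
  have h : ∀ X Y, ∑ i, φ X (e i) * inner ℝ (e i) Y = φ X Y := fun X Y => by
    conv_rhs => rw [← e.sum_repr' Y]
    rw [← IsLinearMap.mk'_apply (hφ X), map_sum]
    simp [mul_comm]
  have h1 : ∀ i, φ (e i) Y * inner ℝ X (e i) = φ Y (e i) * inner ℝ (e i) X := fun i => by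
    rw [hs, real_inner_comm]
  simp only [ricciContraction, kulkarniNomizu, metricTensor, traceTensor, Finset.sum_sub_distrib,
    Finset.sum_add_distrib, ← Finset.sum_mul, ← Finset.mul_sum, h, h1, hs Y X]
  have h4 : ∑ i, (inner ℝ (e i) (e i) : ℝ) = 4 := by simp
  rw [h4]
  ring

theorem scalarPart_kulkarniNomizu {φ : U → U → ℝ} (hφ : ∀ X, IsLinearMap ℝ (φ X))
    (hs : ∀ X Y, φ X Y = φ Y X) :
    scalarPart e (kulkarniNomizu φ metricTensor) = -6 * traceTensor e φ := by
  have h4 : ∑ i, (inner ℝ (e i) (e i) : ℝ) = 4 := by simp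
  have h : ∀ i, ricciContraction e (kulkarniNomizu φ metricTensor) (e i) (e i) =
      -(2 * φ (e i) (e i) + traceTensor e φ * inner ℝ (e i) (e i)) :=
    fun i => ricciContraction_kulkarniNomizu e hφ hs _ _
  rw [scalarPart, traceTensor]
  simp only [h, Finset.sum_neg_distrib, Finset.sum_add_distrib, ← Finset.mul_sum, h4]
  simp only [traceTensor]
  ring

/-- The Weyl tensor does not change if the Kulkarni-Nomizu product of a symmetric bilinear form
with the scalar product is added. -/
theorem weyl_add_kulkarniNomizu (Q : U → U → U → U → ℝ) {φ : U → U → ℝ}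
    (hφ : ∀ X, IsLinearMap ℝ (φ X)) (hs : ∀ X Y, φ X Y = φ Y X) :
    weyl e (fun X Y Z W => Q X Y Z W + kulkarniNomizu φ metricTensor X Y Z W) = weyl e Q := by
  have hc : ∀ X Y, ricciContraction e
      (fun X Y Z W => Q X Y Z W + kulkarniNomizu φ metricTensor X Y Z W) X Y =
      ricciContraction e Q X Y - (2 * φ X Y + traceTensor e φ * metricTensor X Y) := fun X Y => by
    rw [sub_eq_add_neg, ← ricciContraction_kulkarniNomizu e hφ hs X Y]
    exact Finset.sum_add_distrib
  have hsc : scalarPart e (fun X Y Z W => Q X Y Z W + kulkarniNomizu φ metricTensor X Y Z W) =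
      scalarPart e Q - 6 * traceTensor e φ := by
    have h := scalarPart_kulkarniNomizu e hφ hs
    have h' : scalarPart e (fun X Y Z W => Q X Y Z W + kulkarniNomizu φ metricTensor X Y Z W) =
        scalarPart e Q + scalarPart e (kulkarniNomizu φ metricTensor) := by
      simp only [scalarPart, traceTensor, ricciContraction, Finset.sum_add_distrib]
    rw [h', h]
    ring
  generalize hQ' : (fun X Y Z W => Q X Y Z W + kulkarniNomizu φ metricTensor X Y Z W) = Q'
    at hc hsc ⊢
  funext X Y Z W
  have hv : Q' X Y Z W = Q X Y Z W + kulkarniNomizu φ metricTensor X Y Z W := by rw [← hQ']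
  simp only [weyl, tracefreeRicci, kulkarniNomizu, hc, hsc, hv, Fintype.card_fin]
  push_cast
  ring

/-- Each of the four Kronecker deltas contracts one index of each pair of q, and the anti-symmetries
turn every contraction into ± the Ricci contraction. -/
theorem sum_mul_kulkarniNomizu {ι : Type*} [Fintype ι] [DecidableEq ι] {q : ι → ι → ι → ι → ℝ}
    (h1 : ∀ i j k l, q i j k l = -q j i k l) (h2 : ∀ i j k l, q i j k l = -q i j l k)
    (p : ι → ι → ℝ) :
    ∑ i, ∑ j, ∑ k, ∑ l, q i j k l * (p i k * (if j = l then 1 else 0)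
      + p j l * (if i = k then 1 else 0) - p i l * (if j = k then 1 else 0)
      - p j k * (if i = l then 1 else 0)) = -4 * ∑ j, ∑ k, (∑ i, q i j k i) * p j k := by
  have t1 : ∑ i, ∑ j, ∑ k, ∑ l, q i j k l * (p i k * if j = l then 1 else 0) =
      -∑ j, ∑ k, (∑ i, q i j k i) * p j k := by
    simp only [← Finset.sum_neg_distrib]
    refine Finset.sum_congr rfl fun i _ => ?_
    rw [Finset.sum_comm]
    refine Finset.sum_congr rfl fun k _ => ?_
    simp [Finset.sum_mul, h1 i]
  have t2 : ∑ i, ∑ j, ∑ k, ∑ l, q i j k l * (p j l * if i = k then 1 else 0) =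
      -∑ j, ∑ k, (∑ i, q i j k i) * p j k := by
    rw [Finset.sum_comm]
    simp only [← Finset.sum_neg_distrib]
    refine Finset.sum_congr rfl fun j _ => ?_
    simp only [Finset.sum_comm (t := Finset.univ (α := ι)) (f := fun k l => q _ j k l * _)]
    rw [Finset.sum_comm]
    refine Finset.sum_congr rfl fun k _ => ?_
    simp [Finset.sum_mul, fun i => h2 i j i k]
  have t3 : ∑ i, ∑ j, ∑ k, ∑ l, q i j k l * (p i l * if j = k then 1 else 0) =
      ∑ j, ∑ k, (∑ i, q i j k i) * p j k := by
    refine Finset.sum_congr rfl fun i _ => ?_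
    simp only [Finset.sum_comm (t := Finset.univ (α := ι)) (f := fun k l => q i _ k l * _)]
    rw [Finset.sum_comm]
    refine Finset.sum_congr rfl fun k _ => ?_
    simp [Finset.sum_mul, fun j => h1 i j j k, fun j => h2 j i j k]
  have t4 : ∑ i, ∑ j, ∑ k, ∑ l, q i j k l * (p j k * if i = l then 1 else 0) =
      ∑ j, ∑ k, (∑ i, q i j k i) * p j k := by
    rw [Finset.sum_comm]
    refine Finset.sum_congr rfl fun j _ => ?_
    rw [Finset.sum_comm]
    refine Finset.sum_congr rfl fun k _ => ?_
    simp [Finset.sum_mul]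
  simp only [mul_add, mul_sub, Finset.sum_add_distrib, Finset.sum_sub_distrib, t1, t2, t3, t4]
  ring

/-- Expand the square and apply `sum_mul_kulkarniNomizu` to q and to the product K itself, whose
contraction is -2p - (tr p) g. -/
theorem sum_sq_add_kulkarniNomizu {q : Fin 4 → Fin 4 → Fin 4 → Fin 4 → ℝ}
    (h1 : ∀ i j k l, q i j k l = -q j i k l) (h2 : ∀ i j k l, q i j k l = -q i j l k)
    (p : Fin 4 → Fin 4 → ℝ) :
    ∑ i, ∑ j, ∑ k, ∑ l, (q i j k l + (p i k * (if j = l then 1 else 0)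
      + p j l * (if i = k then 1 else 0) - p i l * (if j = k then 1 else 0)
      - p j k * (if i = l then 1 else 0))) ^ 2 =
    ∑ i, ∑ j, ∑ k, ∑ l, q i j k l ^ 2 - 8 * ∑ j, ∑ k, (∑ i, q i j k i) * p j k
      + 8 * ∑ j, ∑ k, p j k ^ 2 + 4 * (∑ i, p i i) ^ 2 := by
  let K : Fin 4 → Fin 4 → Fin 4 → Fin 4 → ℝ := fun i j k l => p i k * (if j = l then 1 else 0)
      + p j l * (if i = k then 1 else 0) - p i l * (if j = k then 1 else 0)
      - p j k * (if i = l then 1 else 0)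
  have hq := sum_mul_kulkarniNomizu h1 h2 p
  have hK := sum_mul_kulkarniNomizu (q := K) (fun i j k l => by simp only [K]; ring)
    (fun i j k l => by simp only [K]; ring) p
  have hc : ∀ j k, ∑ i, K i j k i = -2 * p j k - (∑ i, p i i) * (if j = k then 1 else 0) :=
    fun j k => by
      simp only [K, Finset.sum_sub_distrib, Finset.sum_add_distrib, ← Finset.sum_mul]
      simp
      ring
  have hexp : ∀ i j k l, (q i j k l + K i j k l) ^ 2 = q i j k l ^ 2 + 2 * (q i j k l * K i j k l)
      + K i j k l * K i j k l := fun i j k l => by ring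
  have hp : ∑ j, ∑ k, (∑ i, K i j k i) * p j k =
      -2 * ∑ j, ∑ k, p j k ^ 2 - (∑ i, p i i) ^ 2 := by
    simp only [hc, sub_mul, Finset.sum_sub_distrib, mul_assoc, ← Finset.mul_sum]
    simp [sq]
  calc _ = ∑ i, ∑ j, ∑ k, ∑ l, (q i j k l + K i j k l) ^ 2 := rfl
    _ = ∑ i, ∑ j, ∑ k, ∑ l, q i j k l ^ 2 + 2 * (∑ i, ∑ j, ∑ k, ∑ l, q i j k l * K i j k l)
      + ∑ i, ∑ j, ∑ k, ∑ l, K i j k l * K i j k l := by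
        simp only [hexp, Finset.sum_add_distrib, Finset.mul_sum]
    _ = _ := by
      rw [hp] at hK
      linear_combination 2 * hq + hK

theorem IsAlgebraicCurvatureTensor.tensorNorm₄_sq {Q : U → U → U → U → ℝ}
    (hQ : IsAlgebraicCurvatureTensor Q) :
    tensorNorm₄ e Q ^ 2 = tensorNorm₄ e (weyl e Q) ^ 2
      + 2 * tensorNorm₂ e (ricciContraction e Q) ^ 2 - 1 / 3 * scalarPart e Q ^ 2 := by
  rw [tensorNorm₄, tensorNorm₄, tensorNorm₂, Real.sq_sqrt (by positivity),
    Real.sq_sqrt (by positivity), Real.sq_sqrt (by positivity)]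
  let r : Fin 4 → Fin 4 → ℝ := fun i j => ricciContraction e Q (e i) (e j)
  let s := scalarPart e Q
  have hs : ∑ i, r i i = s := rfl
  -- For n = 4 both correction terms of `weyl` merge into one product p ∧ g, where -1/12 = -1/8 +
  -- 1/24 collects the coefficients of s g.
  let p : Fin 4 → Fin 4 → ℝ := fun i j => r i j / 2 - s / 12 * (if i = j then 1 else 0)
  have hw : ∀ i j k l, weyl e Q (e i) (e j) (e k) (e l) = Q (e i) (e j) (e k) (e l)
      + (p i k * (if j = l then 1 else 0)
      + p j l * (if i = k then 1 else 0) - p i l * (if j = k then 1 else 0)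
      - p j k * (if i = l then 1 else 0)) := fun i j k l => by
    simp only [weyl, kulkarniNomizu, tracefreeRicci, metricTensor_basis, Fintype.card_fin, p, r, s]
    push_cast
    ring
  have hmain := sum_sq_add_kulkarniNomizu (q := fun i j k l => Q (e i) (e j) (e k) (e l))
    (fun _ _ _ _ => hQ.antisymm_left _ _ _ _) (fun _ _ _ _ => hQ.antisymm_right _ _ _ _) p
  have hδ : ∑ j, ∑ k, r j k * (if j = k then 1 else 0) = s := by
    rw [← hs]
    simp
  have hδ' : ∑ j : Fin 4, ∑ k : Fin 4, (if j = k then 1 else 0 : ℝ) = 4 := by simp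
  have hrp : ∑ j, ∑ k, r j k * p j k = (∑ j, ∑ k, r j k ^ 2) / 2 - s ^ 2 / 12 := by
    have h : ∀ j k, r j k * p j k = r j k ^ 2 / 2 - s / 12 * (r j k * if j = k then 1 else 0) :=
      fun j k => by simp only [p]; ring
    simp only [h, Finset.sum_sub_distrib, ← Finset.sum_div, ← Finset.mul_sum, hδ]
    ring
  have hpp : ∑ j, ∑ k, p j k ^ 2 = (∑ j, ∑ k, r j k ^ 2) / 4 - s ^ 2 / 18 := by
    have h : ∀ j k, p j k ^ 2 = r j k ^ 2 / 4 - s / 12 * (r j k * if j = k then 1 else 0)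
        + s ^ 2 / 144 * (if j = k then 1 else 0) := fun j k => by
      simp only [p]
      split_ifs <;> ring
    simp only [h, Finset.sum_add_distrib, Finset.sum_sub_distrib, ← Finset.sum_div,
      ← Finset.mul_sum, hδ, hδ']
    ring
  have hpt : ∑ i, p i i = s / 6 := by
    simp only [p, Finset.sum_sub_distrib, ← Finset.sum_div, hs]
    simp
    ring
  simp only [hw]
  rw [hmain]
  change _ = _ - 8 * (∑ j, ∑ k, r j k * p j k) + _ + _ + 2 * (∑ j, ∑ k, r j k ^ 2) - 1 / 3 * s ^ 2
  rw [hrp, hpp, hpt]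
  ring

/-- Pair symmetrisation symmetrises the contraction. In the contraction of the Bianchi part, one
term vanishes and the other two cancel, already for each basis vector. -/
theorem ricciContraction_bianchiKer_pairSymm {R : U → U → U → U → ℝ}
    (hl : ∀ X Y Z W, R X Y Z W = -R Y X Z W) (hr : ∀ X Y Z W, R X Y Z W = -R X Y W Z) :
    ricciContraction e (bianchiKer (pairSymm R)) = symmPart (ricciContraction e R) := by
  funext X Y
  simp only [ricciContraction, symmPart, ← Finset.sum_add_distrib, Finset.sum_div]
  refine Finset.sum_congr rfl fun i _ => ?_
  simp only [bianchiKer, bianchi, pairSymm]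
  linarith [hl (e i) (e i) X Y, hr X Y (e i) (e i), hl Y (e i) X (e i), hr (e i) Y X (e i),
    hl Y (e i) (e i) X, hr (e i) Y (e i) X, hl X (e i) (e i) Y, hr X (e i) (e i) Y,
    hl X (e i) Y (e i), hr Y (e i) X (e i), hr (e i) X (e i) Y]

theorem traceTensor_symmPart (k : U → U → ℝ) :
    traceTensor e (symmPart k) = traceTensor e k :=
  Finset.sum_congr rfl fun i _ => by simp only [symmPart]; ring

end WeylAlgebra

/-! ### Comparison with the Riemannian curvature -/

section OrthogonalConnection

variable {E : Type*} [NormedAddCommGroup E] [NormedSpace ℝ E] [FiniteDimensional ℝ E]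
  {H : Type*} [TopologicalSpace H] {I : ModelWithCorners ℝ E H}
  {M : Type*} [TopologicalSpace M] [ChartedSpace H M] [IsManifold I ∞ M]
  [RiemannianBundle (fun x : M => TangentSpace I x)]
  [IsContMDiffRiemannianBundle I ∞ E (fun x : M => TangentSpace I x)]

theorem inner_torsionOp_skew {x : M} (V : TangentSpace I x)
    (T : TangentSpace I x [⋀^Fin 3]→L[ℝ] ℝ) (X Z W : TangentSpace I x) :
    (inner ℝ (torsionOp V T X Z) W : ℝ) = -inner ℝ (torsionOp V T X W) Z := by
  rw [inner_torsionOp, inner_torsionOp, swap_right_threeForm]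
  ring

theorem inner_torsionOp_torsionOp {ι : Type*} [Fintype ι] {x : M}
    (e : OrthonormalBasis ι ℝ (TangentSpace I x)) (V : TangentSpace I x)
    (T : TangentSpace I x [⋀^Fin 3]→L[ℝ] ℝ) (X Y Z W : TangentSpace I x) :
    inner ℝ (torsionOp V T X (torsionOp V T Y Z)) W =
      (inner ℝ Y Z * inner ℝ V X - inner ℝ V Z * inner ℝ X Y) * inner ℝ V W
        - (inner ℝ Y Z * inner ℝ V V - inner ℝ V Z * inner ℝ V Y) * inner ℝ X W
      + (T ![Y, Z, X] * inner ℝ V W - T ![Y, Z, V] * inner ℝ X W + inner ℝ Y Z * T ![X, V, W]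
        - inner ℝ V Z * T ![X, Y, W])
      + -∑ l, T ![X, W, e l] * T ![Y, Z, e l] := by
  have h : T ![X, torsionOp V T Y Z, W] = inner ℝ Y Z * T ![X, V, W] - inner ℝ V Z * T ![X, Y, W]
      + -∑ l, T ![X, W, e l] * T ![Y, Z, e l] := by
    -- Parseval's identity for the two vectors that represent T(X,W,·) and T(Y,Z,·).
    have hG : ∑ l, T ![X, W, e l] * T ![Y, Z, e l] =
        T ![X, W, sharp (insertTwo T Y Z)] := by
      have := e.sum_inner_mul_inner (sharp (insertTwo T X W)) (sharp (insertTwo T Y Z))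
      rw [inner_sharp, insertTwo_apply] at this
      rw [← this]
      refine Finset.sum_congr rfl fun l _ => ?_
      rw [inner_sharp, real_inner_comm, inner_sharp, insertTwo_apply, insertTwo_apply]
    rw [hG, swap_right_threeForm, ← insertTwo_apply T X W, torsionOp, map_add, map_sub, map_smul,
      map_smul]
    simp only [insertTwo_apply, smul_eq_mul]
    rw [swap_right_threeForm T X W V, swap_right_threeForm T X W Y]
    ring
  rw [inner_torsionOp V T X, h, real_inner_comm (torsionOp V T Y Z) X,
    real_inner_comm (torsionOp V T Y Z) V, inner_torsionOp,
    inner_torsionOp, real_inner_comm X Y, real_inner_comm V Y]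
  ring

theorem riem_swap_left (cov : CovariantDerivative I E (TangentSpace I : M → Type _)) (x : M)
    (X Y Z W : TangentSpace I x) : riem cov x X Y Z W = -riem cov x Y X Z W := by
  rw [riem, riem, ← inner_neg_left]
  congr 1
  simp only [curvatureField]
  rw [mlieBracket_swap_apply, map_neg]
  abel

variable {cov : CovariantDerivative I E (TangentSpace I : M → Type _)}
  {V : Π x : M, TangentSpace I x} {T : Π x : M, TangentSpace I x [⋀^Fin 3]→L[ℝ] ℝ}

/-- The connection is metric: each operator A(X,·) is skew, hence so are the commutators, and the
derivative terms inherit the skewness. -/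
theorem HasTorsionComponents.riem_swap_right (hcov : HasTorsionComponents cov V T)
    (hT : IsSmoothThreeForm T) {x : M} (hV : CMDiffAt ∞ (T% V) x) (X Y Z W : TangentSpace I x) :
    riem cov x X Y Z W = -riem cov x X Y W Z := by
  rw [hcov.riem_eq hT hV, hcov.riem_eq hT hV,
    (isAlgebraicCurvatureTensor_riem_leviCivita x).antisymm_right X Y Z W,
    covDerivThreeForm_swap_right T (extend E X), covDerivThreeForm_swap_right T (extend E Y),
    inner_torsionOp_skew _ _ X _ W, inner_torsionOp_skew _ _ Y _ W,
    inner_torsionOp_skew _ _ X _ Z, inner_torsionOp_skew _ _ Y _ Z,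
    real_inner_comm (torsionOp _ _ X Z), real_inner_comm (torsionOp _ _ Y Z)]
  ring

/-- In dimension four, the pair-symmetric part of the curvature tensor in the kernel of the Bianchi
map differs from the Riemannian curvature tensor by a Kulkarni-Nomizu product with the metric. -/
theorem HasTorsionComponents.exists_bianchiKer_pairSymm_riem (hcov : HasTorsionComponents cov V T)
    (hT : IsSmoothThreeForm T) {x : M} (hV : CMDiffAt ∞ (T% V) x)
    (e : OrthonormalBasis (Fin 4) ℝ (TangentSpace I x)) :
    ∃ φ : TangentSpace I x → TangentSpace I x → ℝ, (∀ X, IsLinearMap ℝ (φ X)) ∧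
      (∀ X Y, φ X Y = φ Y X) ∧
      bianchiKer (pairSymm (riem cov x)) = fun X Y Z W => riem leviCivita x X Y Z W
        + kulkarniNomizu φ metricTensor X Y Z W := by
  have ht1 : ∀ X Y Z, T x ![X, Y, Z] = -T x ![Y, X, Z] := swap_left_threeForm (T x)
  have ht2 : ∀ X Y Z, T x ![X, Y, Z] = -T x ![X, Z, Y] := swap_right_threeForm (T x)
  have hu : ∀ X Y Z X' : TangentSpace I x, Function.update ![X, Y, Z] 0 X' = ![X', Y, Z] :=
    fun X Y Z X' => by
      funext i
      fin_cases i <;> rfl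
  obtain ⟨θ, hθ⟩ := exists_gram_threeForm e (t := fun X Y Z => T x ![X, Y, Z]) ht1 ht2
    (fun X X' Y Z => by simpa only [hu] using (T x).map_update_add ![X, Y, Z] 0 X X')
    (fun c X Y Z => by simpa only [hu, smul_eq_mul] using (T x).map_update_smul ![X, Y, Z] 0 c X)
  let v := V x
  let B : TangentSpace I x → TangentSpace I x → ℝ := fun X Y => inner ℝ (leviCivita V x X) Y
  -- The three summands come from ∇V, from the square of V and from the square of T.
  refine ⟨fun X Y => -symmPart B X Y + (inner ℝ v v / 2 * inner ℝ X Y - inner ℝ v X * inner ℝ v Y)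
    + (inner ℝ θ θ / 2 * inner ℝ X Y - inner ℝ θ X * inner ℝ θ Y), fun X => ⟨fun Y Y' => ?_,
    fun c Y => ?_⟩, fun X Y => ?_, ?_⟩
  · simp only [symmPart, B, map_add, inner_add_left, inner_add_right]
    ring
  · simp only [symmPart, B, map_smul, real_inner_smul_left, real_inner_smul_right, smul_eq_mul]
    ring
  · simp only [symmPart, real_inner_comm X Y]
    ring
  -- Sorted by type: ∇T, ∇V, V², V times T, T². The first and the fourth vanish under the
  -- projection.
  have hR : riem cov x = riem leviCivita x
      + (fun X Y Z W =>
        covDerivThreeForm T (extend E X) (extend E Y) (extend E Z) (extend E W) x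
        - covDerivThreeForm T (extend E Y) (extend E X) (extend E Z) (extend E W) x)
      + (fun X Y Z W => inner ℝ Y Z * B X W - B X Z * inner ℝ Y W
        - (inner ℝ X Z * B Y W - B Y Z * inner ℝ X W))
      + (fun X Y Z W =>
        (inner ℝ Y Z * inner ℝ v X - inner ℝ v Z * inner ℝ X Y) * inner ℝ v W
          - (inner ℝ Y Z * inner ℝ v v - inner ℝ v Z * inner ℝ v Y) * inner ℝ X W
        - ((inner ℝ X Z * inner ℝ v Y - inner ℝ v Z * inner ℝ Y X) * inner ℝ v W
          - (inner ℝ X Z * inner ℝ v v - inner ℝ v Z * inner ℝ v X) * inner ℝ Y W))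
      + (fun X Y Z W =>
        T x ![Y, Z, X] * inner ℝ v W - T x ![Y, Z, v] * inner ℝ X W + inner ℝ Y Z * T x ![X, v, W]
          - inner ℝ v Z * T x ![X, Y, W]
        - (T x ![X, Z, Y] * inner ℝ v W - T x ![X, Z, v] * inner ℝ Y W
          + inner ℝ X Z * T x ![Y, v, W] - inner ℝ v Z * T x ![Y, X, W]))
      + (fun X Y Z W => -(∑ l, T x ![X, W, e l] * T x ![Y, Z, e l])
        - -∑ l, T x ![Y, W, e l] * T x ![X, Z, e l]) := by
    funext X Y Z W
    rw [hcov.riem_eq hT hV, inner_torsionOp_torsionOp e, inner_torsionOp_torsionOp e]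
    simp only [Pi.add_apply, B, v]
    ring
  funext X Y Z W
  rw [hR]
  simp only [bianchiKer_pairSymm_add]
  rw [(isAlgebraicCurvatureTensor_riem_leviCivita x).bianchiKer_pairSymm,
    bianchiKer_pairSymm_deriv_eq_zero (D := fun X Y Z W => covDerivThreeForm T (extend E X)
      (extend E Y) (extend E Z) (extend E W) x) (fun _ _ _ _ => covDerivThreeForm_swap_left ..)
      (fun _ _ _ _ => covDerivThreeForm_swap_right ..), bianchiKer_pairSymm_vectorial,
    bianchiKer_pairSymm_vectorial_sq,
    bianchiKer_pairSymm_mixed (t := fun X Y Z => T x ![X, Y, Z]) ht1 ht2,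
    bianchiKer_pairSymm_gram (G := fun a b c d => ∑ l, T x ![a, b, e l] * T x ![c, d, e l]) hθ]
  simp only [kulkarniNomizu]
  ring

end OrthogonalConnection

theorem mainTheorem9
    {M : Type*} [TopologicalSpace M] [ChartedSpace (EuclideanSpace ℝ (Fin 4)) M]
    [IsManifold (𝓡 4) ∞ M]
    [RiemannianBundle (fun x : M => TangentSpace (𝓡 4) x)]
    [IsContMDiffRiemannianBundle (𝓡 4) ∞ (EuclideanSpace ℝ (Fin 4))
      (fun x : M => TangentSpace (𝓡 4) x)]
    (V : Π x : M, TangentSpace (𝓡 4) x)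
    (hV : ContMDiff (𝓡 4) (𝓡 4).tangent ∞
      (fun x => (⟨x, V x⟩ : TangentBundle (𝓡 4) M)))
    (T : Π x : M, TangentSpace (𝓡 4) x [⋀^Fin 3]→L[ℝ] ℝ)
    (hT : IsSmoothThreeForm T)
    (cov : CovariantDerivative (𝓡 4) (EuclideanSpace ℝ (Fin 4))
      (TangentSpace (𝓡 4) : M → Type _))
    (hcov : HasTorsionComponents cov V T)
    (p : M) (e : OrthonormalBasis (Fin 4) ℝ (TangentSpace (𝓡 4) p)) :
    IsAlgebraicCurvatureTensor (riem (leviCivita (I := 𝓡 4) (M := M)) p) ∧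
    IsAlgebraicCurvatureTensor (bianchiKer (pairSymm (riem cov p))) ∧
    weyl e (riem (leviCivita (I := 𝓡 4) (M := M)) p)
      = weyl e (bianchiKer (pairSymm (riem cov p))) ∧
    tensorNorm₄ e (bianchiKer (pairSymm (riem cov p))) ^ 2
      = tensorNorm₄ e (weyl e (riem (leviCivita (I := 𝓡 4) (M := M)) p)) ^ 2
        + 2 * tensorNorm₂ e (symmPart (ricciContraction e (riem cov p))) ^ 2
        - 1 / 3 * traceTensor e (ricciContraction e (riem cov p)) ^ 2 := by
  have hg := isAlgebraicCurvatureTensor_riem_leviCivita (I := 𝓡 4) (M := M) p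
  have hVp : ContMDiffAt (𝓡 4) (𝓡 4).tangent ∞
      (fun x => (⟨x, V x⟩ : TangentBundle (𝓡 4) M)) p := hV p
  obtain ⟨φ, hφ, hs, hQ⟩ := hcov.exists_bianchiKer_pairSymm_riem hT hVp e
  have hK : IsAlgebraicCurvatureTensor (bianchiKer (pairSymm (riem cov p))) := by
    rw [hQ]
    exact hg.add_kulkarniNomizu hφ hs
  have hW : weyl e (riem (leviCivita (I := 𝓡 4) (M := M)) p)
      = weyl e (bianchiKer (pairSymm (riem cov p))) := by
    rw [hQ, weyl_add_kulkarniNomizu e _ hφ hs]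
  have hric := ricciContraction_bianchiKer_pairSymm e (riem_swap_left cov p)
    (hcov.riem_swap_right hT hVp)
  refine ⟨hg, hK, hW, ?_⟩
  -- The contraction of riem^S_ker is ric^S, whose trace equals that of ric.
  rw [hK.tensorNorm₄_sq e, hW, scalarPart, hric, traceTensor_symmPart]
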